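/- **Setting.** All vector lattices are real. A vector lattice $E$ is Archimedean if $x\ge 0$ and $nx\le y$ for all $n\in\mathbb N$ imply $x=0$. For a topological space $X$, $S(X)$ denotes the vector lattice of real-valued continuous functions defined on open dense subsets of $X$, two of them being identified when they agree on an open dense set, with pointwise operations and order; $C(X)$ is regarded as a subset of $S(X)$. A net $(x_\alpha)$ converges to $x$ in order ($x_\alpha\xrightarrow{o}x$) if there is a net $u_\gamma\downarrow 0$, possibly over a different index set, such that for each $\gamma$ there is $\alpha_0$ with $|x_\alpha-x|\le u_\gamma$ for all $\alpha\ge\alpha_0$; and $x_\alpha\xrightarrow{uo}x$ if $|x_\alpha-x|\wedge u\xrightarrow{o}0$ for every $u\ge 0$. A vector sublattice $Y$ of $F$ is order dense if for each $0<g\in F$ there is $y\in Y$ with $0<y\le g$, and regular if infima of nonempty subsets of $Y$ that exist in $Y$ are also infima in $F$. A *band decomposition* of $E$ is a family of pairwise disjoint bands $(B_i)_{i\in I}$ of $E$, each with a weak unit $e_i$ (that is, $0\le e_i\in B_i$, and $x\in B_i$, $|x|\wedge e_i=0$ imply $x=0$), such that only $0$ is disjoint from all the $B_i$. A *Wickstead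 representation* of $E$ with respect to it consists of compact Hausdorff spaces $X_i$ with disjoint union $X=\bigsqcup_i X_i$, and a linear lattice homomorphism $T:E\to S(X)$ such that, for each $i$, the component $T_i:E\to S(X_i)$ of $T$ (the restriction of $T(\cdot)$ to $X_i$) is one-to-one on $B_i$, satisfies $T_i(e_i)=\mathbf 1_{X_i}$, and maps the ideal $\{x:\ |x|\le c\,e_i \text{ for some } c\in\mathbb R\}$ onto a set whose closure in $S(X_i)$, for uniform distance, is exactly $C(X_i)$. **Theorem.** Let $E$ be an Archimedean vector lattice. Then $E$ has a band decomposition, and for each band decomposition of $E$ there is a Wickstead representation. For each Wickstead representation $T:E\to S(X)$ with respect to any band decomposition of $E$: 1. $T$ is one-to-one; 2. $T$ is order continuous: $x_\alpha\xrightarrow{o}x$ in $E$ implies $Tx_\alpha\xrightarrow{o}Tx$ in $S(X)$; 3. $T$ is $uo$-continuous: $x_\alpha\xrightarrow{uo}x$ in $E$ implies $Tx_\alpha\xrightarrow{uo}Tx$ in $S(X)$; 4. $T^{-1}:T(E)\to E$ is $uo$-continuous: $Tx_\alpha\xrightarrow{uo}Tx$ in $S(X)$ implies $x_\alpha\xrightarrow{uo}x$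 in $E$; 5. $T(E)$ is order dense in $S(X)$, and it is a regular sublattice of $S(X)$. Here $(x_\alpha)$ runs over all nets in $E$ and $x$ over all elements of $E$. -/

import Mathlib

open Filter

universe u v w w'

/-! ### Vector lattices: convergence, order density, regularity, bands -/

section VectorLattice

variable {E : Type u} [Lattice E] [AddCommGroup E]

/-- A vector lattice is Archimedean if `x ≥ 0` and `n x ≤ y` for all `n` force `x = 0`. -/
def IsArchimedeanLattice (E : Type u) [Lattice E] [AddCommGroup E] : Prop :=
  ∀ x y : E, 0 ≤ x → (∀ n : ℕ, n • x ≤ y) → x = 0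

/-- Order convergence of a net `x` to `a`: some net `d ↓ 0`, possibly over another directed set
`Γ`, has the property that for every `γ`, eventually `|x i - a| ≤ d γ`. (Allowing `Γ` in the
universe of `E` is no restriction: a net may be replaced by its range.) -/
def OrderConvergesTo {A : Type w} [Preorder A] (x : A → E) (a : E) : Prop :=
  ∃ (Γ : Type u) (_ : Preorder Γ) (_ : IsDirected Γ (· ≤ ·)) (_ : Nonempty Γ) (d : Γ → E),
    Antitone d ∧ IsGLB (Set.range d) 0 ∧ ∀ γ, ∃ i₀, ∀ i, i₀ ≤ i → |x i - a| ≤ d γ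

/-- Unbounded order convergence of a net `x` to `a`: for every `b ≥ 0`, the net `|x i - a| ∧ b`
converges to `0` in order. -/
def UOConvergesTo {A : Type w} [Preorder A] (x : A → E) (a : E) : Prop :=
  ∀ b : E, 0 ≤ b → OrderConvergesTo (fun i => |x i - a| ⊓ b) 0

/-- `Y` is order dense: below each strictly positive element there is a strictly positive
element of `Y`. -/
def IsOrderDense (Y : Set E) : Prop :=
  ∀ g : E, 0 < g → ∃ y ∈ Y, 0 < y ∧ y ≤ g

/-- `Y` is regular: whenever a nonempty `A ⊆ Y` has an infimum `a` computed in `Y`, then `a` is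
the infimum of `A` in the whole space. -/
def IsRegularIn (Y : Set E) : Prop :=
  ∀ A : Set E, A.Nonempty → A ⊆ Y → ∀ a ∈ Y,
    (∀ y ∈ A, a ≤ y) → (∀ b ∈ Y, (∀ y ∈ A, b ≤ y) → b ≤ a) → IsGLB A a

/-- A band: a solid vector subspace which contains all existing suprema of its subsets. -/
structure IsBand [Module ℝ E] (B : Submodule ℝ E) : Prop where
  solid : ∀ x y : E, |x| ≤ |y| → y ∈ B → x ∈ B
  sup_mem : ∀ A : Set E, A ⊆ (B : Set E) → ∀ a : E, IsLUB A a → a ∈ B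

/-- `e` is a weak unit of the band `B`. -/
structure IsWeakUnitOf [Module ℝ E] (B : Submodule ℝ E) (e : E) : Prop where
  mem : e ∈ B
  nonneg : 0 ≤ e
  eq_zero : ∀ x ∈ B, |x| ⊓ e = 0 → x = 0

/-- A decomposition of `E` into pairwise disjoint bands `B i` with weak units `e i`.
Only the zero vector is disjoint to all the bands, i.e. the band generated by all the `B i`
is `E`. -/
structure IsBandDecomposition [Module ℝ E] {ι : Type v} (B : ι → Submodule ℝ E) (e : ι → E) :
    Prop where
  band : ∀ i, IsBand (B i)
  weakUnit : ∀ i, IsWeakUnitOf (B i) (e i)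
  disjoint : ∀ i j, i ≠ j → ∀ x ∈ B i, ∀ y ∈ B j, |x| ⊓ |y| = 0
  complete : ∀ x : E, (∀ i, ∀ y ∈ B i, |x| ⊓ |y| = 0) → x = 0

end VectorLattice

/-! ### The vector lattice `S(X)` -/

section SX

/-- The filter on `X` generated by the open dense subsets. -/
def openDenseFilter (X : Type u) [TopologicalSpace X] : Filter X where
  sets := {s | ∃ U ⊆ s, IsOpen U ∧ Dense U}
  univ_sets := ⟨Set.univ, subset_rfl, isOpen_univ, dense_univ⟩
  sets_of_superset := fun ⟨U, h, hU⟩ hst => ⟨U, h.trans hst, hU⟩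
  inter_sets := fun ⟨U, h, hU, hU'⟩ ⟨V, k, hV, hV'⟩ =>
    ⟨U ∩ V, Set.inter_subset_inter h k, hU.inter hV, hU'.inter_of_isOpen_left hV' hU⟩

variable {X : Type u} [TopologicalSpace X]

theorem mem_openDenseFilter {s : Set X} :
    s ∈ openDenseFilter X ↔ ∃ U ⊆ s, IsOpen U ∧ Dense U := Iff.rfl

/-- A class of functions, modulo equality on an open dense set, with a representative that is
continuous on some open dense set. -/
def IsSGerm (g : Germ (openDenseFilter X) ℝ) : Prop :=
  ∃ (f : X → ℝ) (U : Set X), IsOpen U ∧ Dense U ∧ ContinuousOn f U ∧ g = (f : Germ _ ℝ)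

theorem IsSGerm.map₂ {op : ℝ → ℝ → ℝ} (hop : Continuous fun p : ℝ × ℝ => op p.1 p.2)
    {g h : Germ (openDenseFilter X) ℝ} (hg : IsSGerm g) (hh : IsSGerm h) :
    IsSGerm (Germ.map₂ op g h) := by
  obtain ⟨f, U, hU, hU', hf, rfl⟩ := hg
  obtain ⟨k, V, hV, hV', hk, rfl⟩ := hh
  exact ⟨fun x => op (f x) (k x), U ∩ V, hU.inter hV, hU'.inter_of_isOpen_left hV' hU,
    hop.comp_continuousOn ((hf.mono Set.inter_subset_left).prodMk (hk.mono Set.inter_subset_right)),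
    rfl⟩

/-- `S(X)` as a linear subspace of the space of all function germs along open dense sets.
A continuous function on an open dense subset is represented by any extension to `X`. Two
continuous real functions on open dense sets `U`, `V` agree on `U ∩ V` if and only if they agree
on some open dense set. -/
def SXSubmodule (X : Type u) [TopologicalSpace X] :
    Submodule ℝ (Germ (openDenseFilter X) ℝ) where
  carrier := {g | IsSGerm g}
  zero_mem' := ⟨fun _ => 0, Set.univ, isOpen_univ, dense_univ, continuousOn_const, rfl⟩
  add_mem' := fun hg hh => hg.map₂ continuous_add hh
  smul_mem' := by
    rintro c _ ⟨f, U, hU, hU', hf, rfl⟩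
    exact ⟨fun x => c • f x, U, hU, hU', hf.const_smul c, rfl⟩

/-- `S(X)`: classes of real functions continuous on open dense subsets of `X`, modulo equality on
an open dense set, with the pointwise linear and lattice operations. -/
abbrev SX (X : Type u) [TopologicalSpace X] : Type u := SXSubmodule X

/-- Pointwise order and lattice operations (pointwise on a common open dense set). -/
instance SX.instLattice : Lattice (SX X) :=
  Subtype.lattice (fun _ _ hg hh => IsSGerm.map₂ continuous_sup hg hh)
    (fun _ _ hg hh => IsSGerm.map₂ continuous_inf hg hh)

instance SX.instIsOrderedAddMonoid : IsOrderedAddMonoid (SX X) where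
  add_le_add_left a b h c :=
    add_le_add_left (show (a : Germ (openDenseFilter X) ℝ) ≤ b from h) c

instance SX.instIsOrderedModule : IsOrderedModule ℝ (SX X) where
  smul_le_smul_of_nonneg_left := by
    rintro c hc ⟨a, ha⟩ ⟨b, hb⟩ h
    induction a, b using Germ.inductionOn₂ with
    | _ f g =>
      have h' : ∀ᶠ x in openDenseFilter X, f x ≤ g x := h
      exact h'.mono fun x hx => mul_le_mul_of_nonneg_left hx hc
  smul_le_smul_of_nonneg_right := by
    rintro ⟨b, hb⟩ h c d hcd
    induction b using Germ.inductionOn with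
    | _ f =>
      have h' : ∀ᶠ x in openDenseFilter X, 0 ≤ f x := h
      exact h'.mono fun x hx => mul_le_mul_of_nonneg_right hcd hx

/-- The canonical image of `C(X)` in `S(X)`. -/
def SX.ofContinuous (f : C(X, ℝ)) : SX X :=
  ⟨((f : X → ℝ) : Germ (openDenseFilter X) ℝ), f, Set.univ, isOpen_univ, dense_univ,
    f.continuous.continuousOn, rfl⟩

variable {ι : Type v} {Z : ι → Type w} [∀ i, TopologicalSpace (Z i)]

theorem tendsto_sigmaMk_openDenseFilter (i : ι) :
    Tendsto (Sigma.mk i) (openDenseFilter (Z i)) (openDenseFilter (Σ j, Z j)) := by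
  rintro s ⟨U, hUs, hU, hU'⟩
  exact ⟨Sigma.mk i ⁻¹' U, Set.preimage_mono hUs, hU.preimage continuous_sigmaMk,
    hU'.preimage isOpenMap_sigmaMk⟩

/-- The `i`-th component `S(⨆ Z j) → S(Z i)`, restriction to the summand `Z i` of the disjoint
union. -/
def SX.component (i : ι) : SX (Σ j, Z j) →ₗ[ℝ] SX (Z i) where
  toFun g := ⟨(g : Germ (openDenseFilter (Σ j, Z j)) ℝ).compTendsto (Sigma.mk i)
      (tendsto_sigmaMk_openDenseFilter i), by
    obtain ⟨_, f, U, hU, hU', hf, rfl⟩ := g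
    exact ⟨f ∘ Sigma.mk i, Sigma.mk i ⁻¹' U, hU.preimage continuous_sigmaMk,
      hU'.preimage isOpenMap_sigmaMk,
      hf.comp continuous_sigmaMk.continuousOn (Set.mapsTo_preimage _ _), rfl⟩⟩
  map_add' := by
    rintro ⟨_, f, U, hU, hU', hf, rfl⟩ ⟨_, k, V, hV, hV', hk, rfl⟩
    rfl
  map_smul' := by
    rintro c ⟨_, f, U, hU, hU', hf, rfl⟩
    rfl

end SX

/-! ### The representation -/

section Representation

variable {E : Type u} [Lattice E] [AddCommGroup E] [Module ℝ E]

/-- `τ` represents the band `B` with weak unit `e` in `S(X)`: it is one-to-one on `B`, it maps `e`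
to the constant function `1`, and the closure, for the uniform distance in `S(X)`, of the image of
the ideal `{x | ∃ c, |x| ≤ c e}` generated by `e` is exactly `C(X)`. -/
structure IsWeakUnitRepresentation {X : Type w} [TopologicalSpace X] (B : Submodule ℝ E) (e : E)
    (τ : E →ₗ[ℝ] SX X) : Prop where
  injOn : Set.InjOn τ B
  map_unit : τ e = SX.ofContinuous 1
  closure_eq : ∀ g : SX X, (∃ f : C(X, ℝ), g = SX.ofContinuous f) ↔
    ∀ ε : ℝ, 0 < ε → ∃ x : E, (∃ c : ℝ, |x| ≤ c • e) ∧
      |τ x - g| ≤ ε • (SX.ofContinuous 1 : SX X)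

/-- `T : E → S(⨆ Z i)` is the representation built from the band decomposition `B`, `e` of `E`:
a linear lattice homomorphism whose `i`-th component represents the band `B i` in `S(Z i)` with
`e i ↦ 1`. -/
structure IsBandRepresentation {ι : Type v} {Z : ι → Type w} [∀ i, TopologicalSpace (Z i)]
    (B : ι → Submodule ℝ E) (e : ι → E) (T : E →ₗ[ℝ] SX (Σ i, Z i)) : Prop where
  map_sup : ∀ x y : E, T (x ⊔ y) = T x ⊔ T y
  component : ∀ i, IsWeakUnitRepresentation (B i) (e i) (SX.component i ∘ₗ T)

end Representation

/-! Decomposition: take a maximal set of pairwise disjoint nonnegative elements `e`, each with its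
double disjoint complement as band.

Representation for one unit `e`: in the ideal `I` generated by `e`, the real lattice homomorphisms
with value 1 at `e` form a compact Hausdorff space. They separate the elements of `I` because `I` is
Archimedean (a homomorphism is built from a maximal filter), and `I` is uniformly dense in the
continuous functions by the lattice form of Stone-Weierstrass. An element `x` of `E` is null at a
point `φ` when `φ (|x| ⊓ e) = 0`, and has a value at `φ` when it differs from an element of `I` by a
null one. For `x ≥ 0` this holds, with `x ⊓ n • e`, wherever `φ (x ⊓ n • e) < n`. If an open set `V`
contained no such point for any `n`, a bump `y` in `I` living on `V` would satisfy `n • y ≤ x` for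
all `n`. So `x` becomes a continuous function on an open dense set (`dense_regularSet`). As `S` of a
disjoint union is the product of the `S`, the representations of the bands assemble into one.

Properties: everything follows from two facts, that `T` is injective and that its range is order
dense. If `T x = 0`, then `|x| ⊓ e i` lies in `B i` and is killed, hence is zero for every `i`. For
density, a positive function dominates a multiple of a bump on one summand; uniform approximation
with a margin puts the image of an element of the ideal of `e i` below it, and that image vanishes
on the other summands. Order density gives regularity, hence order continuity. For uo-convergence,
`inf_le_sub_inf_nsmul` turns a bound on `y ⊓ g` into one on `y ⊓ b`, and
`eq_zero_of_le_sub_inf_nsmul` shows that these bounds suffice; both directions then need no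
completion of `E`. -/

set_option linter.unusedSectionVars false

/-! ### Lattice-ordered groups -/

section LatticeGroup

variable {E : Type u} [Lattice E] [AddCommGroup E] [IsOrderedAddMonoid E]

theorem eq_zero_of_abs_le_zero {a : E} (h : |a| ≤ 0) : a = 0 :=
  le_antisymm ((le_abs_self a).trans h) (neg_nonpos.1 ((neg_le_abs a).trans h))

theorem inf_add_le_inf_add_inf {a b c : E} (ha : 0 ≤ a) (hb : 0 ≤ b) (hc : 0 ≤ c) :
    a ⊓ (b + c) ≤ a ⊓ b + a ⊓ c := by
  rw [add_inf, inf_add, inf_add]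
  refine le_inf (le_inf ?_ ?_) (le_inf ?_ inf_le_right)
  · exact inf_le_left.trans (le_add_of_nonneg_right ha)
  · exact inf_le_left.trans (le_add_of_nonneg_left hb)
  · exact inf_le_left.trans (le_add_of_nonneg_right hc)

theorem inf_add_eq_zero {a b c : E} (ha : 0 ≤ a) (hb : 0 ≤ b) (hc : 0 ≤ c)
    (h : a ⊓ b = 0) (h' : a ⊓ c = 0) : a ⊓ (b + c) = 0 :=
  le_antisymm (by simpa [h, h'] using inf_add_le_inf_add_inf ha hb hc)
    (le_inf ha (add_nonneg hb hc))

theorem inf_nsmul_eq_zero {a b : E} (ha : 0 ≤ a) (hb : 0 ≤ b) (h : a ⊓ b = 0) (n : ℕ) :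
    a ⊓ n • b = 0 := by
  induction n with
  | zero => simpa using ha
  | succ n ih =>
    rw [succ_nsmul]
    exact inf_add_eq_zero ha (nsmul_nonneg hb n) hb ih h

theorem inf_eq_zero_of_le {a b c d : E} (ha : 0 ≤ a) (hb : 0 ≤ b) (hac : a ≤ c) (hbd : b ≤ d)
    (h : c ⊓ d = 0) : a ⊓ b = 0 :=
  le_antisymm ((inf_le_inf hac hbd).trans h.le) (le_inf ha hb)

theorem sub_inf_eq_sub_sup_zero (a b : E) : a - a ⊓ b = (a - b) ⊔ 0 := by
  rw [sub_inf, sub_self, sup_comm]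

theorem sub_sup_zero_inf_sub_sup_zero_swap (a b : E) : ((a - b) ⊔ 0) ⊓ ((b - a) ⊔ 0) = 0 := by
  have := posPart_inf_negPart_eq_zero (a - b)
  rwa [posPart_def, negPart_def, neg_sub] at this

theorem sup_zero_add_sup_zero_neg (a : E) : a ⊔ 0 - (-a) ⊔ 0 = a := by
  simpa only [posPart_def, negPart_def] using posPart_sub_negPart a

/-- The part `(y - d) ⊔ 0` is disjoint from `(g - d) ⊔ 0`, hence from `z` and its multiples, while
`b - d ≤ (b - y) ⊔ 0 + (y - d) ⊔ 0`. The new bound does not mention `d`, so it can be moved through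
`T` when only `z`, `g` and `b` are in the right lattice. -/
theorem inf_le_sub_inf_nsmul {y b g d z : E} (h : y ⊓ g ≤ d) (hz : 0 ≤ z) (hzd : z ≤ g - d)
    (n : ℕ) : y ⊓ b ≤ b - (b - g + z) ⊓ n • z := by
  have hdisj : ((y - d) ⊔ 0) ⊓ n • z = 0 := by
    let _ := AddCommGroup.toDistribLattice E
    refine inf_nsmul_eq_zero le_sup_right hz (le_antisymm ?_ (le_inf le_sup_right hz)) n
    calc ((y - d) ⊔ 0) ⊓ z ≤ ((y - d) ⊔ 0) ⊓ ((g - d) ⊔ 0) :=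
          inf_le_inf_left _ (hzd.trans le_sup_left)
      _ = ((y - d) ⊓ (g - d)) ⊔ 0 := (sup_inf_right _ _ _).symm
      _ ≤ 0 := sup_le (by rwa [← inf_sub, sub_nonpos]) le_rfl
  rw [le_sub_comm]
  have h2 : b - y ⊓ b = (b - y) ⊔ 0 := by rw [inf_comm, sub_inf_eq_sub_sup_zero]
  rw [h2]
  have h3 : b - g + z ≤ ((b - y) ⊔ 0) + ((y - d) ⊔ 0) := by
    have : b - g + z ≤ b - d := by
      calc b - g + z ≤ b - g + (g - d) := by gcongr
        _ = b - d := by abel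
    refine this.trans ?_
    calc b - d = (b - y) + (y - d) := by abel
      _ ≤ _ := add_le_add le_sup_left le_sup_left
  calc (b - g + z) ⊓ n • z ≤ (((b - y) ⊔ 0) + ((y - d) ⊔ 0)) ⊓ n • z := inf_le_inf_right _ h3
    _ ≤ n • z ⊓ ((b - y) ⊔ 0) + n • z ⊓ ((y - d) ⊔ 0) := by
      rw [inf_comm]
      exact inf_add_le_inf_add_inf (nsmul_nonneg hz n) le_sup_right le_sup_right
    _ ≤ (b - y) ⊔ 0 := by
      rw [inf_comm (n • z) ((y - d) ⊔ 0), hdisj, add_zero]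
      exact inf_le_right

/-- If `n • z ≤ b - g`, then `(n + 1) • z ≤ b - g + z`, so the infimum in `h (n + 1)` is `(n + 1) •
z` and the bound propagates to all multiples. -/
theorem eq_zero_of_le_sub_inf_nsmul (hE : IsArchimedeanLattice E) {b g z : E} (hg : g ≤ b)
    (hz : 0 ≤ z) (h : ∀ n : ℕ, g ≤ b - (b - g + z) ⊓ n • z) : z = 0 := by
  refine hE z (b - g) hz fun n => ?_
  induction n with
  | zero => simpa using hg
  | succ n ih =>
    have h1 : (n + 1) • z ≤ b - g + z := by
      rw [succ_nsmul]
      gcongr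
    have h2 := le_sub_comm.1 (h (n + 1))
    rwa [inf_eq_right.2 h1] at h2

theorem isLUB_sup_const {A : Set E} (hA : A.Nonempty) {a : E} (h : IsLUB A a) (c : E) :
    IsLUB ((· ⊔ c) '' A) (a ⊔ c) := by
  refine ⟨?_, fun b hb => sup_le (h.2 fun x hx => ?_) ?_⟩
  · rintro _ ⟨x, hx, rfl⟩
    exact sup_le_sup_right (h.1 hx) c
  · exact le_sup_left.trans (hb ⟨x, hx, rfl⟩)
  · obtain ⟨x, hx⟩ := hA
    exact le_sup_right.trans (hb ⟨x, hx, rfl⟩)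

theorem inf_eq_zero_of_isLUB {A : Set E} (hA : A.Nonempty) {a y : E} (h : IsLUB A a) (hy : 0 ≤ y)
    (hAy : ∀ x ∈ A, |x| ⊓ y = 0) : |a| ⊓ y = 0 := by
  have hpos : (a ⊔ 0) ⊓ y = 0 := by
    have ha : 0 ≤ (a ⊔ 0) ⊓ y := le_inf le_sup_right hy
    refine le_antisymm ?_ ha
    -- Each `x ⊔ 0` is disjoint from `(a ⊔ 0) ⊓ y`, so their sum is their supremum and stays below
    -- `a ⊔ 0`: removing the common part leaves an upper bound.
    have hub : a ⊔ 0 ≤ (a ⊔ 0) - (a ⊔ 0) ⊓ y := by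
      refine (isLUB_sup_const hA h 0).2 ?_
      rintro _ ⟨x, hx, rfl⟩
      have hxa : x ⊔ 0 ≤ a ⊔ 0 := sup_le_sup_right (h.1 hx) 0
      have hd : (x ⊔ 0) ⊓ ((a ⊔ 0) ⊓ y) = 0 :=
        inf_eq_zero_of_le le_sup_right ha (sup_le (le_abs_self x) (abs_nonneg x)) inf_le_right
          (hAy x hx)
      have hs := inf_add_sup (x ⊔ 0) ((a ⊔ 0) ⊓ y)
      rw [hd, zero_add] at hs
      change x ⊔ 0 ≤ _
      rw [le_sub_iff_add_le, ← hs]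
      exact sup_le hxa inf_le_left
    simpa using hub
  -- The negative part of `a` is below that of any single `x ∈ A`.
  have hneg : ((-a) ⊔ 0) ⊓ y = 0 := by
    obtain ⟨x, hx⟩ := hA
    refine inf_eq_zero_of_le le_sup_right hy (sup_le ?_ (abs_nonneg x)) le_rfl (hAy x hx)
    exact (neg_le_neg (h.1 hx)).trans (neg_le_abs x)
  have habs : |a| = (a ⊔ 0) + ((-a) ⊔ 0) := by
    simpa only [posPart_def, negPart_def] using (posPart_add_negPart a).symm
  rw [habs, inf_comm]
  exact inf_add_eq_zero hy le_sup_right le_sup_right (by rwa [inf_comm]) (by rwa [inf_comm])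

end LatticeGroup

/-! ### Disjoint complements and existence of band decompositions -/

section VectorLattice

variable {E : Type u} [Lattice E] [AddCommGroup E] [IsOrderedAddMonoid E] [Module ℝ E]
  [IsOrderedModule ℝ E]

theorem abs_real_smul_le (c : ℝ) (x : E) : |c • x| ≤ |c| • |x| := by
  rw [abs_le']
  rcases le_total 0 c with h | h
  · rw [abs_of_nonneg h, ← smul_neg]
    exact ⟨smul_le_smul_of_nonneg_left (le_abs_self x) h,
      smul_le_smul_of_nonneg_left (neg_le_abs x) h⟩
  · rw [abs_of_nonpos h, ← neg_smul]
    refine ⟨?_, smul_le_smul_of_nonneg_left (le_abs_self x) (neg_nonneg.2 h)⟩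
    have := smul_le_smul_of_nonneg_left (neg_le_abs x) (neg_nonneg.2 h)
    simpa using this

theorem real_smul_le_nsmul {x : E} (hx : 0 ≤ x) {c : ℝ} {n : ℕ} (h : c ≤ n) : c • x ≤ n • x := by
  rw [← Nat.cast_smul_eq_nsmul ℝ]
  exact smul_le_smul_of_nonneg_right h hx

theorem smul_sup_of_nonneg {c : ℝ} (hc : 0 ≤ c) (x y : E) : c • (x ⊔ y) = c • x ⊔ c • y := by
  rcases hc.eq_or_lt with rfl | hc
  · simp
  refine le_antisymm ?_ (sup_le (smul_le_smul_of_nonneg_left le_sup_left hc.le)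
    (smul_le_smul_of_nonneg_left le_sup_right hc.le))
  have h : x ⊔ y ≤ c⁻¹ • (c • x ⊔ c • y) := by
    refine sup_le ?_ ?_
    · simpa [smul_smul, hc.ne'] using
        smul_le_smul_of_nonneg_left (le_sup_left : c • x ≤ c • x ⊔ c • y) (inv_nonneg.2 hc.le)
    · simpa [smul_smul, hc.ne'] using
        smul_le_smul_of_nonneg_left (le_sup_right : c • y ≤ c • x ⊔ c • y) (inv_nonneg.2 hc.le)
  simpa [smul_smul, hc.ne'] using smul_le_smul_of_nonneg_left h hc.le

theorem inf_real_smul_eq_zero {a b : E} (ha : 0 ≤ a) (hb : 0 ≤ b) (h : a ⊓ b = 0) {c : ℝ}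
    (hc : 0 ≤ c) : a ⊓ c • b = 0 := by
  obtain ⟨n, hn⟩ := exists_nat_ge c
  exact inf_eq_zero_of_le ha (smul_nonneg hc hb) le_rfl (real_smul_le_nsmul hb hn)
    (inf_nsmul_eq_zero ha hb h n)

/-- The disjoint complement of a set. -/
def disjointComplement (S : Set E) : Submodule ℝ E where
  carrier := {x | ∀ y ∈ S, |x| ⊓ |y| = 0}
  zero_mem' y _ := by simp
  add_mem' {a b} ha hb y hy := by
    refine inf_eq_zero_of_le (abs_nonneg _) (abs_nonneg _) (abs_add_le a b) le_rfl ?_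
    rw [inf_comm]
    exact inf_add_eq_zero (abs_nonneg _) (abs_nonneg _) (abs_nonneg _)
      (by rw [inf_comm, ha y hy]) (by rw [inf_comm, hb y hy])
  smul_mem' c x hx y hy := by
    refine inf_eq_zero_of_le (abs_nonneg _) (abs_nonneg _) (abs_real_smul_le c x) le_rfl ?_
    rw [inf_comm]
    exact inf_real_smul_eq_zero (abs_nonneg _) (abs_nonneg _) (by rw [inf_comm, hx y hy])
      (abs_nonneg c)

theorem isBand_disjointComplement (S : Set E) : IsBand (disjointComplement S) where
  solid x y hxy hy z hz :=
    inf_eq_zero_of_le (abs_nonneg _) (abs_nonneg _) hxy le_rfl (hy z hz)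
  sup_mem A hA a ha y hy := by
    rcases A.eq_empty_or_nonempty with rfl | hne
    -- A supremum of the empty set is a least element; comparing it with `a - |a|` gives `|a| ≤ 0`.
    · have hbot : ∀ b : E, a ≤ b := fun b => ha.2 (by simp)
      exact le_antisymm (inf_le_left.trans (by simpa using hbot (a - |a|))) (le_inf (abs_nonneg _) (abs_nonneg _))
    · exact inf_eq_zero_of_isLUB hne ha (abs_nonneg y) fun x hx => hA hx y hy

theorem eq_zero_of_abs_inf_self {x : E} (h : |x| ⊓ |x| = 0) : x = 0 :=
  eq_zero_of_abs_le_zero (by simpa using h.le)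

theorem exists_isBandDecomposition :
    ∃ (ι : Type u) (B : ι → Submodule ℝ E) (e : ι → E), IsBandDecomposition B e := by
  obtain ⟨M, hM⟩ := zorn_subset
    {S : Set E | (∀ x ∈ S, 0 ≤ x) ∧ ∀ x ∈ S, ∀ y ∈ S, x ≠ y → x ⊓ y = 0} (by
      intro c hc hchain
      refine ⟨⋃₀ c, ⟨?_, ?_⟩, fun s hs => Set.subset_sUnion_of_mem hs⟩
      · rintro x ⟨s, hs, hx⟩
        exact (hc hs).1 x hx
      · rintro x ⟨s, hs, hx⟩ y ⟨t, ht, hy⟩ hxy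
        rcases hchain.total hs ht with hst | hst
        · exact (hc ht).2 x (hst hx) y hy hxy
        · exact (hc hs).2 x hx y (hst hy) hxy)
  obtain ⟨hpos, hdisj⟩ := hM.prop
  refine ⟨M, fun e => disjointComplement (disjointComplement {(e : E)}), fun e => e,
    fun _ => isBand_disjointComplement _, fun e => ⟨?_, hpos e e.2, ?_⟩, ?_, ?_⟩
  · intro y hy
    rw [inf_comm]
    exact hy _ rfl
  · intro x hx hxe
    refine eq_zero_of_abs_inf_self (hx x fun y hy => ?_)
    rw [Set.mem_singleton_iff.1 hy, abs_of_nonneg (hpos e e.2), hxe]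
  · intro i j hij x hx y hy
    refine hx y fun z hz => ?_
    rw [Set.mem_singleton_iff.1 hz, inf_comm]
    rw [inf_comm]
    refine hy _ fun t ht => ?_
    rw [Set.mem_singleton_iff.1 ht, abs_of_nonneg (hpos i i.2), abs_of_nonneg (hpos j j.2)]
    exact hdisj _ i.2 _ j.2 fun h => hij (Subtype.ext h)
  · intro x hx
    have hxM : ∀ y ∈ M, |x| ⊓ y = 0 := by
      intro y hy
      have := hx ⟨y, hy⟩ y fun z hz => by
        rw [inf_comm]
        exact hz _ rfl
      rwa [abs_of_nonneg (hpos y hy)] at this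
    -- By maximality `|x|` already belongs to `M`, so it is disjoint from itself.
    have hmem : |x| ∈ M := by
      refine hM.le_of_ge (y := insert |x| M) ⟨?_, ?_⟩ (Set.subset_insert _ _)
        (Set.mem_insert _ _)
      · rintro y (rfl | hy)
        exacts [abs_nonneg x, hpos y hy]
      · rintro y (rfl | hy) z (rfl | hz) hyz
        · exact absurd rfl hyz
        · exact hxM z hz
        · rw [inf_comm]
          exact hxM y hy
        · exact hdisj y hy z hz hyz
    exact eq_zero_of_abs_inf_self (hxM _ hmem)

end VectorLattice

/-! ### Order convergence through eventual upper bounds -/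

section Convergence

variable {E : Type u} [Lattice E] [AddCommGroup E]

/-- The elements which dominate a net eventually. -/
def eventualUpperBounds {A : Type w} [Preorder A] (y : A → E) : Set E :=
  {u | ∃ i₀, ∀ i, i₀ ≤ i → y i ≤ u}

variable {A : Type w} [Preorder A] [IsDirected A (· ≤ ·)] [Nonempty A]

theorem nonneg_of_mem_eventualUpperBounds {y : A → E} (hy : ∀ i, 0 ≤ y i) {u : E}
    (hu : u ∈ eventualUpperBounds y) : 0 ≤ u := by
  obtain ⟨i, hi⟩ := hu
  exact (hy i).trans (hi i le_rfl)

theorem inf_mem_eventualUpperBounds {y : A → E} {u v : E}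
    (hu : u ∈ eventualUpperBounds y) (hv : v ∈ eventualUpperBounds y) :
    u ⊓ v ∈ eventualUpperBounds y := by
  obtain ⟨i, hi⟩ := hu
  obtain ⟨j, hj⟩ := hv
  obtain ⟨k, hik, hjk⟩ := exists_ge_ge i j
  exact ⟨k, fun l hl => le_inf (hi l (hik.trans hl)) (hj l (hjk.trans hl))⟩

variable [IsOrderedAddMonoid E]

/-- The eventual upper bounds contain every admissible dominating net, and, being closed under `⊓`,
form one themselves in the reversed order. Nonemptiness provides the index. -/
theorem orderConvergesTo_iff {x : A → E} {a : E} :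
    OrderConvergesTo x a ↔ (eventualUpperBounds fun i => |x i - a|).Nonempty ∧
      IsGLB (eventualUpperBounds fun i => |x i - a|) 0 := by
  constructor
  · rintro ⟨Γ, _, _, ⟨γ₀⟩, d, -, hglb, hd⟩
    refine ⟨⟨d γ₀, hd γ₀⟩, fun u hu => nonneg_of_mem_eventualUpperBounds (fun _ => abs_nonneg _) hu,
      fun b hb => hglb.2 ?_⟩
    rintro _ ⟨γ, rfl⟩
    exact hb (hd γ)
  · rintro ⟨hne, hglb⟩
    let D := eventualUpperBounds fun i => |x i - a|
    refine ⟨(↥D)ᵒᵈ, inferInstance, ⟨fun u v => ?_⟩, ?_, fun u => (OrderDual.ofDual u : D).1,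
      fun u v h => h, ?_, fun u => (OrderDual.ofDual u : D).2⟩
    · exact ⟨OrderDual.toDual ⟨_, inf_mem_eventualUpperBounds (OrderDual.ofDual u).2
        (OrderDual.ofDual v).2⟩, (inf_le_left : _ ⊓ _ ≤ (OrderDual.ofDual u : D).1),
        (inf_le_right : _ ⊓ _ ≤ (OrderDual.ofDual v : D).1)⟩
    · obtain ⟨u, hu⟩ := hne
      exact ⟨OrderDual.toDual ⟨u, hu⟩⟩
    · convert hglb
      ext u
      exact ⟨fun ⟨v, hv⟩ => hv ▸ (OrderDual.ofDual v : D).2,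
        fun hu => ⟨OrderDual.toDual ⟨u, hu⟩, rfl⟩⟩

theorem uoConvergesTo_iff {x : A → E} {a : E} :
    UOConvergesTo x a ↔
      ∀ b : E, 0 ≤ b → IsGLB (eventualUpperBounds fun i => |x i - a| ⊓ b) 0 := by
  refine forall₂_congr fun b hb => ?_
  have h : (fun i => |(|x i - a| ⊓ b - 0)|) = fun i => |x i - a| ⊓ b := by
    funext i
    rw [sub_zero, abs_of_nonneg (le_inf (abs_nonneg _) hb)]
  rw [orderConvergesTo_iff, h, and_iff_right]
  obtain ⟨i⟩ := ‹Nonempty A›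
  exact ⟨b, i, fun _ _ => inf_le_right⟩

end Convergence

/-! ### Lattice homomorphisms with order dense range -/

section LatticeHom

variable {E : Type u} [Lattice E] [AddCommGroup E] [IsOrderedAddMonoid E]
  {F : Type v} [Lattice F] [AddCommGroup F] [IsOrderedAddMonoid F] {T : E →+ F}

theorem map_inf_of_map_sup (hT : ∀ x y, T (x ⊔ y) = T x ⊔ T y) (x y : E) :
    T (x ⊓ y) = T x ⊓ T y := by
  have h := hT (-x) (-y)
  rw [← neg_inf, map_neg, map_neg, map_neg, ← neg_inf, neg_inj] at h
  exact h

theorem map_abs_of_map_sup (hT : ∀ x y, T (x ⊔ y) = T x ⊔ T y) (x : E) : T |x| = |T x| := by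
  rw [abs, hT, map_neg, abs]

theorem monotone_of_map_sup (hT : ∀ x y, T (x ⊔ y) = T x ⊔ T y) : Monotone T := fun x y h => by
  rw [← sup_eq_right.2 h, hT]
  exact le_sup_left

theorem le_iff_of_map_sup (hT : ∀ x y, T (x ⊔ y) = T x ⊔ T y) (hinj : Function.Injective T)
    {x y : E} : T x ≤ T y ↔ x ≤ y :=
  ⟨fun h => sup_eq_right.1 (hinj ((hT x y).trans (sup_eq_right.2 h))),
    fun h => monotone_of_map_sup hT h⟩

/-- A lower bound `b` not below `T a` leaves room for some `0 < T z ≤ (b - T a) ⊔ 0`, and then `T (a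
+ z)` is a larger lower bound inside the range. -/
theorem IsOrderDense.isRegularIn_range (hd : IsOrderDense (Set.range T)) : IsRegularIn (Set.range T) := by
  rintro A - hA a ⟨a, rfl⟩ hlb hglb
  refine ⟨hlb, fun b hb => ?_⟩
  by_contra hba
  have hpos : 0 < (b - T a) ⊔ 0 := by
    refine lt_of_le_of_ne le_sup_right fun h => hba (sub_nonpos.1 ?_)
    exact le_sup_left.trans h.symm.le
  obtain ⟨_, ⟨z, rfl⟩, hz, hzb⟩ := hd _ hpos
  have h : T (a + z) ≤ T a := by
    refine hglb _ ⟨_, rfl⟩ fun y hy => ?_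
    rw [map_add, ← le_sub_iff_add_le']
    exact hzb.trans (sup_le (sub_le_sub_right (hb hy) _) (sub_nonneg.2 (hlb y hy)))
  rw [map_add] at h
  exact (lt_add_of_pos_right _ hz).not_ge h

theorem OrderConvergesTo.map_of_isOrderDense (hT : ∀ x y, T (x ⊔ y) = T x ⊔ T y)
    (hinj : Function.Injective T) (hd : IsOrderDense (Set.range T))
    {A : Type w} [Preorder A] [IsDirected A (· ≤ ·)] [Nonempty A] {x : A → E} {a : E}
    (h : OrderConvergesTo x a) : OrderConvergesTo (fun i => T (x i)) (T a) := by
  rw [orderConvergesTo_iff] at h ⊢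
  obtain ⟨hne, hglb⟩ := h
  have hmem : ∀ u ∈ eventualUpperBounds fun i => |x i - a|,
      T u ∈ eventualUpperBounds fun i => |T (x i) - T a| := by
    rintro u ⟨i, hi⟩
    refine ⟨i, fun j hj => ?_⟩
    change |T (x j) - T a| ≤ T u
    rw [← map_sub, ← map_abs_of_map_sup hT]
    exact monotone_of_map_sup hT (hi j hj)
  refine ⟨hne.elim fun u hu => ⟨T u, hmem u hu⟩, ?_, fun b hb => ?_⟩
  · exact fun u hu => nonneg_of_mem_eventualUpperBounds (fun _ => abs_nonneg _) hu
  · have hreg := hd.isRegularIn_range (T '' eventualUpperBounds fun i => |x i - a|)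
      (hne.image _) (Set.image_subset_range _ _) (T 0) ⟨0, rfl⟩ ?_ ?_
    · rw [map_zero] at hreg
      refine hreg.2 ?_
      rintro _ ⟨u, hu, rfl⟩
      exact hb (hmem u hu)
    · rintro _ ⟨u, hu, rfl⟩
      exact monotone_of_map_sup hT (hglb.1 hu)
    · rintro _ ⟨c, rfl⟩ hc
      exact monotone_of_map_sup hT (hglb.2 fun u hu =>
        (le_iff_of_map_sup hT hinj).1 (hc _ ⟨u, hu, rfl⟩))

/-- Choose `0 < T k` below a putative positive lower bound and test the convergence in `E` against
`k`. Each eventual upper bound `d` of `|x i - a| ⊓ k` yields, with `z = T (k - k ⊓ d)`, eventual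
upper bounds of `|T (x i) - T a| ⊓ b` forcing `z = 0`, so `k ≤ d`; hence `k ≤ 0`. -/
theorem UOConvergesTo.map_of_isOrderDense (hF : IsArchimedeanLattice F)
    (hT : ∀ x y, T (x ⊔ y) = T x ⊔ T y)
    (hinj : Function.Injective T) (hd : IsOrderDense (Set.range T))
    {A : Type w} [Preorder A] [IsDirected A (· ≤ ·)] [Nonempty A] {x : A → E} {a : E}
    (h : UOConvergesTo x a) : UOConvergesTo (fun i => T (x i)) (T a) := by
  rw [uoConvergesTo_iff] at h ⊢
  intro b hb
  refine ⟨fun u hu => nonneg_of_mem_eventualUpperBounds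
    (fun _ => le_inf (abs_nonneg _) hb) hu, fun g hg => ?_⟩
  by_contra hg0
  have hpos : 0 < g ⊔ 0 :=
    lt_of_le_of_ne le_sup_right fun h => hg0 (le_sup_left.trans h.symm.le)
  have hlb : ∀ u ∈ eventualUpperBounds fun i => |T (x i) - T a| ⊓ b, g ⊔ 0 ≤ u := fun u hu =>
    sup_le (hg hu) (nonneg_of_mem_eventualUpperBounds (fun _ => le_inf (abs_nonneg _) hb) hu)
  obtain ⟨_, ⟨k, rfl⟩, hk, hkg⟩ := hd _ hpos
  have hkb : T k ≤ b := hkg.trans (hlb b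
    (‹Nonempty A›.elim fun i => ⟨i, fun _ _ => inf_le_right⟩))
  have hk0 : 0 ≤ k := (le_iff_of_map_sup hT hinj).1 (by simpa using hk.le)
  refine hk.not_ge ?_
  rw [← map_zero T]
  refine monotone_of_map_sup hT ((h k hk0).2 fun d hdmem => ?_)
  obtain ⟨i, hi⟩ := hdmem
  have hz : k - k ⊓ d = 0 := by
    apply hinj
    rw [map_zero]
    have hw : 0 ≤ T (k - k ⊓ d) := by
      rw [← map_zero T]
      exact monotone_of_map_sup hT (sub_nonneg.2 inf_le_left)
    refine eq_zero_of_le_sub_inf_nsmul hF hkb hw fun n => hkg.trans (hlb _ ⟨i, fun j hj => ?_⟩)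
    refine inf_le_sub_inf_nsmul (d := T (k ⊓ d)) ?_ hw (map_sub T _ _).le n
    rw [← map_sub, ← map_abs_of_map_sup hT, ← map_inf_of_map_sup hT]
    exact monotone_of_map_sup hT (le_inf inf_le_right (hi j hj))
  rw [sub_eq_zero] at hz
  exact hz.le.trans inf_le_right

/-- For a lower bound `g ≥ 0`, test the convergence in `F` against `T g`. An eventual upper bound
`d` need not be in the range, but if `T g` is not below `d`, order density supplies `0 < T z ≤ T g -
T g ⊓ d`. The bounds built from `z` pull back to `E` and force `z = 0`. -/
theorem UOConvergesTo.of_map_of_isOrderDense (hE : IsArchimedeanLattice E)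
    (hT : ∀ x y, T (x ⊔ y) = T x ⊔ T y)
    (hinj : Function.Injective T) (hd : IsOrderDense (Set.range T))
    {A : Type w} [Preorder A] [IsDirected A (· ≤ ·)] [Nonempty A] {x : A → E} {a : E}
    (h : UOConvergesTo (fun i => T (x i)) (T a)) : UOConvergesTo x a := by
  rw [uoConvergesTo_iff] at h ⊢
  intro b hb
  refine ⟨fun u hu => nonneg_of_mem_eventualUpperBounds
    (fun _ => le_inf (abs_nonneg _) hb) hu, fun g' hg' => ?_⟩
  have hlb : ∀ u ∈ eventualUpperBounds fun i => |x i - a| ⊓ b, g' ⊔ 0 ≤ u := fun u hu =>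
    sup_le (hg' hu) (nonneg_of_mem_eventualUpperBounds (fun _ => le_inf (abs_nonneg _) hb) hu)
  refine le_sup_left.trans (b := g' ⊔ 0) ?_
  obtain ⟨g, hgdef⟩ : ∃ g, g = g' ⊔ 0 := ⟨_, rfl⟩
  have hg0 : 0 ≤ g := hgdef ▸ le_sup_right
  rw [← hgdef] at hlb ⊢
  have hgb : g ≤ b := hlb b (‹Nonempty A›.elim fun i => ⟨i, fun _ _ => inf_le_right⟩)
  rw [← le_iff_of_map_sup hT hinj, map_zero]
  have hTg : 0 ≤ T g := by
    rw [← map_zero T]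
    exact monotone_of_map_sup hT hg0
  refine (h (T g) hTg).2 fun d hdmem => ?_
  obtain ⟨i, hi⟩ := hdmem
  by_contra hgd
  have hpos : 0 < T g - T g ⊓ d :=
    lt_of_le_of_ne (sub_nonneg.2 inf_le_left) fun h => hgd
      ((sub_eq_zero.1 h.symm).le.trans inf_le_right)
  obtain ⟨_, ⟨z, rfl⟩, hz, hzg⟩ := hd _ hpos
  have hz0 : 0 ≤ z := (le_iff_of_map_sup hT hinj).1 (by simpa using hz.le)
  have hzz : z = 0 := by
    refine eq_zero_of_le_sub_inf_nsmul hE hgb hz0 fun n => hlb _ ⟨i, fun j hj => ?_⟩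
    rw [← le_iff_of_map_sup hT hinj, map_inf_of_map_sup hT, map_abs_of_map_sup hT, map_sub,
      map_sub, map_inf_of_map_sup hT, map_add, map_sub, map_nsmul]
    exact inf_le_sub_inf_nsmul (le_inf inf_le_right (hi j hj)) hz.le hzg n
  rw [hzz, map_zero] at hz
  exact lt_irrefl _ hz

end LatticeHom

/-! ### Representatives of the elements of `S(X)` -/

section SX

variable {X : Type u} [TopologicalSpace X]

/-- `f` is a representative of `g`. -/
def SX.Rep (g : SX X) (f : X → ℝ) : Prop := (g : Germ (openDenseFilter X) ℝ) = (f : Germ _ ℝ)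

/-- The class of a function which is continuous on an open dense set. -/
def SX.mk (f : X → ℝ) (U : Set X) (hU : IsOpen U) (hU' : Dense U) (hf : ContinuousOn f U) : SX X :=
  ⟨(f : Germ (openDenseFilter X) ℝ), f, U, hU, hU', hf, rfl⟩

theorem SX.rep_mk (f : X → ℝ) (U : Set X) (hU : IsOpen U) (hU' : Dense U)
    (hf : ContinuousOn f U) : (SX.mk f U hU hU' hf).Rep f := rfl

theorem SX.exists_rep (g : SX X) :
    ∃ (f : X → ℝ) (U : Set X), IsOpen U ∧ Dense U ∧ ContinuousOn f U ∧ g.Rep f := g.2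

theorem SX.rep_zero : (0 : SX X).Rep fun _ => 0 := rfl

theorem SX.rep_ofContinuous (f : C(X, ℝ)) : (SX.ofContinuous f).Rep f := rfl

namespace SX.Rep

variable {g h : SX X} {f k : X → ℝ}

theorem add (hg : g.Rep f) (hh : h.Rep k) : (g + h).Rep fun x => f x + k x := by
  change (g : Germ (openDenseFilter X) ℝ) + h = _
  rw [hg, hh]
  rfl

theorem smul (c : ℝ) (hg : g.Rep f) : (c • g).Rep fun x => c * f x := by
  change c • (g : Germ (openDenseFilter X) ℝ) = _
  rw [hg]
  rfl

theorem neg (hg : g.Rep f) : (-g).Rep fun x => -f x := by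
  change -(g : Germ (openDenseFilter X) ℝ) = _
  rw [hg]
  rfl

theorem sup (hg : g.Rep f) (hh : h.Rep k) : (g ⊔ h).Rep fun x => f x ⊔ k x := by
  change (g : Germ (openDenseFilter X) ℝ) ⊔ h = _
  rw [hg, hh]
  rfl

theorem inf (hg : g.Rep f) (hh : h.Rep k) : (g ⊓ h).Rep fun x => f x ⊓ k x := by
  change (g : Germ (openDenseFilter X) ℝ) ⊓ h = _
  rw [hg, hh]
  rfl

theorem le_iff (hg : g.Rep f) (hh : h.Rep k) :
    g ≤ h ↔ ∀ᶠ x in openDenseFilter X, f x ≤ k x := by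
  change (g : Germ (openDenseFilter X) ℝ) ≤ h ↔ _
  rw [hg, hh]
  exact Germ.coe_le

theorem eq_iff (hg : g.Rep f) (hh : h.Rep k) :
    g = h ↔ ∀ᶠ x in openDenseFilter X, f x = k x := by
  rw [Subtype.ext_iff]
  rw [hg, hh]
  exact Germ.coe_eq

end SX.Rep

theorem eventually_openDenseFilter {p : X → Prop} {U : Set X} (hU : IsOpen U) (hU' : Dense U)
    (h : ∀ x ∈ U, p x) : ∀ᶠ x in openDenseFilter X, p x := ⟨U, h, hU, hU'⟩

/-- The subset of `U` where the inequality fails is open, so if nonempty it would meet the dense set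
where the inequality holds. -/
theorem le_of_eventually_openDenseFilter {f k : X → ℝ} {U : Set X} (hU : IsOpen U)
    (hf : ContinuousOn f U) (hk : ContinuousOn k U)
    (h : ∀ᶠ x in openDenseFilter X, f x ≤ k x) {x : X} (hx : x ∈ U) : f x ≤ k x := by
  by_contra hlt
  obtain ⟨V, hV, -, hVd⟩ := h
  obtain ⟨y, ⟨hyU, hy⟩, hyV⟩ := hVd.inter_open_nonempty _
    ((hf.sub hk).isOpen_inter_preimage hU isOpen_Ioi)
    ⟨x, hx, (sub_pos.2 (not_le.1 hlt) : f x - k x ∈ Set.Ioi 0)⟩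
  have hy' : 0 < f y - k y := hy
  have : f y ≤ k y := hV hyV
  linarith

theorem SX.ofContinuous_le_iff {f k : C(X, ℝ)} :
    SX.ofContinuous f ≤ SX.ofContinuous k ↔ ∀ x, f x ≤ k x := by
  rw [(SX.rep_ofContinuous f).le_iff (SX.rep_ofContinuous k)]
  exact ⟨fun h x => le_of_eventually_openDenseFilter isOpen_univ f.continuous.continuousOn
    k.continuous.continuousOn h (Set.mem_univ x), fun h => Eventually.of_forall h⟩

theorem SX.abs_ofContinuous_sub_le_iff {f k : C(X, ℝ)} {ε : ℝ} :
    |SX.ofContinuous f - SX.ofContinuous k| ≤ ε • (SX.ofContinuous 1 : SX X) ↔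
      ∀ x, |f x - k x| ≤ ε := by
  have h : |SX.ofContinuous f - SX.ofContinuous k| = SX.ofContinuous |f - k| := rfl
  have h' : ε • (SX.ofContinuous 1 : SX X) = SX.ofContinuous (ε • 1) := rfl
  rw [h, h', SX.ofContinuous_le_iff]
  simp

theorem SX.isArchimedeanLattice : IsArchimedeanLattice (SX X) := by
  intro x y hx h
  obtain ⟨f, U, hU, hUd, hf, hxf⟩ := x.exists_rep
  obtain ⟨k, V, hV, hVd, hk, hyk⟩ := y.exists_rep
  refine le_antisymm ?_ hx
  rw [hxf.le_iff SX.rep_zero]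
  refine eventually_openDenseFilter (hU.inter hV) (hUd.inter_of_isOpen_left hVd hU) fun z hz => ?_
  by_contra hpos
  obtain ⟨n, hn⟩ := Archimedean.arch (k z + 1) (not_le.1 hpos)
  have hn' := h n
  rw [← Nat.cast_smul_eq_nsmul ℝ, (hxf.smul _).le_iff hyk] at hn'
  have := le_of_eventually_openDenseFilter (hU.inter hV)
    ((hf.mono Set.inter_subset_left).const_smul (n : ℝ)) (hk.mono Set.inter_subset_right) hn' hz
  simp only [nsmul_eq_mul] at this hn
  change (n : ℝ) * f z ≤ k z at this
  linarith

theorem SX.eq_zero_of_inf_one {g : SX X} (hg : 0 ≤ g) (h : g ⊓ SX.ofContinuous 1 = 0) : g = 0 := by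
  obtain ⟨f, U, -, -, -, hf⟩ := g.exists_rep
  rw [SX.rep_zero.le_iff hf] at hg
  rw [(hf.inf (SX.rep_ofContinuous 1)).eq_iff SX.rep_zero] at h
  rw [hf.eq_iff SX.rep_zero]
  filter_upwards [hg, h] with x hx hx'
  rcases min_choice (f x) ((1 : C(X, ℝ)) x) with h1 | h1
  · exact h1.symm.trans hx'
  · exact absurd (h1.symm.trans hx') (by simp)

/-- A uniform limit in `S(X)` of continuous functions is a continuous function. -/
theorem SX.exists_eq_ofContinuous [CompactSpace X] {g : SX X}
    (h : ∀ ε : ℝ, 0 < ε → ∃ f : C(X, ℝ),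
      |SX.ofContinuous f - g| ≤ ε • (SX.ofContinuous 1 : SX X)) :
    ∃ f : C(X, ℝ), g = SX.ofContinuous f := by
  choose! f hf using h
  have hdist : ∀ a b : ℝ, 0 < a → 0 < b → dist (f a) (f b) ≤ a + b := by
    intro a b ha hb
    rw [ContinuousMap.dist_le (add_pos ha hb).le]
    have : |SX.ofContinuous (f a) - SX.ofContinuous (f b)| ≤
        (a + b) • (SX.ofContinuous 1 : SX X) := by
      calc _ = |(SX.ofContinuous (f a) - g) + (g - SX.ofContinuous (f b))| := by
            rw [sub_add_sub_cancel]
        _ ≤ |SX.ofContinuous (f a) - g| + |g - SX.ofContinuous (f b)| := abs_add_le _ _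
        _ ≤ _ := by
            rw [abs_sub_comm g, add_smul]
            exact add_le_add (hf a ha) (hf b hb)
    exact SX.abs_ofContinuous_sub_le_iff.1 this
  let s : ℕ → ℝ := fun n => 1 / ((n : ℝ) + 1)
  have hs : ∀ n, 0 < s n := fun n => Nat.one_div_pos_of_nat
  have hs0 : Tendsto s atTop (nhds 0) := tendsto_one_div_add_atTop_nhds_zero_nat
  have hanti : Antitone s := fun m n h => Nat.one_div_le_one_div h
  have hc : CauchySeq fun n => f (s n) := by
    refine cauchySeq_of_le_tendsto_0 (fun n => s n + s n) (fun n m N hn hm => ?_)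
      (by simpa using hs0.add hs0)
    exact (hdist _ _ (hs n) (hs m)).trans (add_le_add (hanti hn) (hanti hm))
  obtain ⟨F, hF⟩ := cauchySeq_tendsto_of_complete hc
  refine ⟨F, ?_⟩
  have hle : ∀ n, dist F (f (s n)) ≤ s n := by
    intro n
    have h1 : Tendsto (fun m => dist (f (s m)) (f (s n))) atTop (nhds (dist F (f (s n)))) :=
      hF.dist tendsto_const_nhds
    have h2 : Tendsto (fun m => s m + s n) atTop (nhds (0 + s n)) := hs0.add_const _
    rw [zero_add] at h2
    exact le_of_tendsto_of_tendsto' h1 h2 fun m => hdist _ _ (hs m) (hs n)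
  rw [← sub_eq_zero]
  -- The distance from `g` to `F` is at most `s m + s m = 2 / (m + 1)`, so its multiple by `m + 1`
  -- is bounded by 2 for every `m`.
  refine eq_zero_of_abs_le_zero (SX.isArchimedeanLattice _ (2 • (SX.ofContinuous 1 : SX X))
    (abs_nonneg _) fun n => ?_).le
  rcases n.eq_zero_or_pos with rfl | hn
  · rw [zero_smul]
    refine nsmul_nonneg ?_ 2
    exact (SX.rep_zero.le_iff (SX.rep_ofContinuous 1)).2 (Eventually.of_forall fun x => zero_le_one)
  obtain ⟨m, rfl⟩ : ∃ m, n = m + 1 := ⟨n - 1, by omega⟩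
  have hbound : |g - SX.ofContinuous F| ≤ (s m + s m) • (SX.ofContinuous 1 : SX X) := by
    calc _ = |(g - SX.ofContinuous (f (s m))) + (SX.ofContinuous (f (s m)) - SX.ofContinuous F)| := by
          rw [sub_add_sub_cancel]
      _ ≤ |g - SX.ofContinuous (f (s m))| + |SX.ofContinuous (f (s m)) - SX.ofContinuous F| :=
          abs_add_le _ _
      _ ≤ _ := by
          rw [abs_sub_comm g, add_smul]
          refine add_le_add (hf _ (hs m)) (SX.abs_ofContinuous_sub_le_iff.2 fun x => ?_)
          rw [← Real.dist_eq, dist_comm]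
          exact (ContinuousMap.dist_apply_le_dist x).trans (hle m)
  refine (nsmul_le_nsmul_right hbound (m + 1)).trans_eq ?_
  rw [← Nat.cast_smul_eq_nsmul ℝ, smul_smul, ← Nat.cast_smul_eq_nsmul ℝ]
  congr 1
  simp only [s]
  push_cast
  field_simp
  norm_num

variable {ι : Type v} {Z : ι → Type w} [∀ i, TopologicalSpace (Z i)]

theorem SX.Rep.component {g : SX (Σ j, Z j)} {f : (Σ j, Z j) → ℝ} (hg : g.Rep f) (i : ι) :
    (SX.component i g).Rep fun z => f ⟨i, z⟩ := by
  change Germ.compTendsto (g : Germ (openDenseFilter (Σ j, Z j)) ℝ) (Sigma.mk i)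
    (tendsto_sigmaMk_openDenseFilter i) = _
  have : (g : Germ (openDenseFilter (Σ j, Z j)) ℝ) = f := hg
  rw [this]
  rfl

theorem isOpen_dense_sigma {W : ∀ i, Set (Z i)} (hW : ∀ i, IsOpen (W i)) (hW' : ∀ i, Dense (W i)) :
    IsOpen {p : Σ i, Z i | p.2 ∈ W p.1} ∧ Dense {p : Σ i, Z i | p.2 ∈ W p.1} := by
  refine ⟨isOpen_sigma_iff.2 fun i => hW i, ?_⟩
  rintro ⟨i, z⟩
  exact map_mem_closure continuous_sigmaMk (hW' i z) fun y hy => hy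

theorem eventually_openDenseFilter_sigma {p : (Σ i, Z i) → Prop} :
    (∀ᶠ x in openDenseFilter (Σ i, Z i), p x) ↔ ∀ i, ∀ᶠ z in openDenseFilter (Z i), p ⟨i, z⟩ := by
  refine ⟨fun h i => (tendsto_sigmaMk_openDenseFilter i).eventually h, fun h => ?_⟩
  choose W hWp hW hW' using h
  obtain ⟨h1, h2⟩ := isOpen_dense_sigma hW hW'
  exact ⟨_, fun x hx => hWp x.1 hx, h1, h2⟩

theorem SX.le_iff_component {g h : SX (Σ i, Z i)} :
    g ≤ h ↔ ∀ i, SX.component i g ≤ SX.component i h := by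
  obtain ⟨f, U, -, -, -, hf⟩ := g.exists_rep
  obtain ⟨k, V, -, -, -, hk⟩ := h.exists_rep
  rw [hf.le_iff hk, eventually_openDenseFilter_sigma]
  exact forall_congr' fun i => ((hf.component i).le_iff (hk.component i)).symm

theorem SX.ext_component {g h : SX (Σ i, Z i)}
    (H : ∀ i, SX.component i g = SX.component i h) : g = h :=
  le_antisymm (SX.le_iff_component.2 fun i => (H i).le) (SX.le_iff_component.2 fun i => (H i).ge)

theorem SX.component_sup (g h : SX (Σ i, Z i)) (i : ι) :
    SX.component i (g ⊔ h) = SX.component i g ⊔ SX.component i h := by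
  obtain ⟨f, U, -, -, -, hf⟩ := g.exists_rep
  obtain ⟨k, V, -, -, -, hk⟩ := h.exists_rep
  exact ((hf.sup hk).component i).trans ((hf.component i).sup (hk.component i)).symm |> Subtype.ext

theorem SX.exists_component_eq (g : ∀ i, SX (Z i)) :
    ∃ h : SX (Σ i, Z i), ∀ i, SX.component i h = g i := by
  choose f U hU hU' hf hg using fun i => (g i).exists_rep
  obtain ⟨h1, h2⟩ := isOpen_dense_sigma hU hU'
  have hc : ContinuousOn (fun p : Σ i, Z i => f p.1 p.2) {p | p.2 ∈ U p.1} := by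
    rintro ⟨i, z⟩ hz
    refine ContinuousAt.continuousWithinAt ?_
    have hz' : ContinuousAt (f i) z := (hf i).continuousAt ((hU i).mem_nhds hz)
    rw [ContinuousAt, ← Topology.IsOpenEmbedding.sigmaMk.map_nhds_eq z, tendsto_map'_iff]
    exact hz'
  exact ⟨SX.mk _ _ h1 h2 hc, fun i => Subtype.ext
    (((SX.rep_mk _ _ h1 h2 hc).component i).trans (hg i).symm)⟩

/-- `S` of a disjoint union is the product of the `S(Z i)`. -/
noncomputable def SX.sigmaEquiv : SX (Σ i, Z i) ≃ₗ[ℝ] ∀ i, SX (Z i) :=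
  LinearEquiv.ofBijective (LinearMap.pi SX.component)
    ⟨fun _ _ h => SX.ext_component fun i => congr_fun h i,
      fun g => (SX.exists_component_eq g).imp fun _ h => funext h⟩

theorem SX.component_sigmaEquiv_symm (g : ∀ i, SX (Z i)) (i : ι) :
    SX.component i (SX.sigmaEquiv.symm g) = g i :=
  congr_fun (SX.sigmaEquiv.apply_symm_apply g) i

end SX

/-! ### The Yosida space of a vector lattice with a strong unit -/

section Yosida

variable {L : Type u} [Lattice L] [AddCommGroup L]

/-- A proper filter of the lattice of nonnegative elements. -/
structure IsProperNonnegFilter (F : Set L) : Prop where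
  nonneg : ∀ y ∈ F, 0 ≤ y
  mem_of_le : ∀ y ∈ F, ∀ z, y ≤ z → z ∈ F
  inf_mem : ∀ y ∈ F, ∀ z ∈ F, y ⊓ z ∈ F
  zero_notMem : (0 : L) ∉ F

variable [IsOrderedAddMonoid L]

theorem exists_maximal_isProperNonnegFilter {u : L} (hu : 0 ≤ u) (hu' : u ≠ 0) :
    ∃ F : Set L, u ∈ F ∧ Maximal IsProperNonnegFilter F := by
  obtain ⟨F, hF, hmax⟩ := zorn_subset_nonempty {F : Set L | IsProperNonnegFilter F} (by
    intro c hc hchain ⟨s, hs⟩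
    refine ⟨⋃₀ c, ⟨?_, ?_, ?_, ?_⟩, fun s hs => Set.subset_sUnion_of_mem hs⟩
    · rintro y ⟨s, hs, hy⟩
      exact (hc hs).nonneg y hy
    · rintro y ⟨s, hs, hy⟩ z hyz
      exact ⟨s, hs, (hc hs).mem_of_le y hy z hyz⟩
    · rintro y ⟨s, hs, hy⟩ z ⟨t, ht, hz⟩
      rcases hchain.total hs ht with hst | hst
      · exact ⟨t, ht, (hc ht).inf_mem y (hst hy) z hz⟩
      · exact ⟨s, hs, (hc hs).inf_mem y hy z (hst hz)⟩
    · rintro ⟨s, hs, h0⟩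
      exact (hc hs).zero_notMem h0) (Set.Ici u)
    ⟨fun y hy => hu.trans hy, fun y hy z hyz => le_trans hy hyz, fun y hy z hz => le_inf hy hz,
      fun h => hu' (le_antisymm h hu)⟩
  exact ⟨F, hF (Set.mem_Ici.2 le_rfl), hmax⟩

/-! ### Maximal filters are prime and stable under positive scalars -/

section MaximalFilter

variable {F : Set L} (hF : Maximal IsProperNonnegFilter F)
include hF

theorem exists_inf_eq_zero_of_notMem {a : L} (ha : 0 ≤ a) (haF : a ∉ F) (hne : F.Nonempty) :
    ∃ f ∈ F, a ⊓ f = 0 := by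
  by_contra! h
  refine haF (hF.le_of_ge (y := {y | ∃ f ∈ F, a ⊓ f ≤ y}) ⟨?_, ?_, ?_, ?_⟩ ?_ ?_)
  · rintro y ⟨f, hf, hy⟩
    exact (le_inf ha (hF.prop.nonneg f hf)).trans hy
  · rintro y ⟨f, hf, hy⟩ z hyz
    exact ⟨f, hf, hy.trans hyz⟩
  · rintro y ⟨f, hf, hy⟩ z ⟨g, hg, hz⟩
    exact ⟨f ⊓ g, hF.prop.inf_mem f hf g hg,
      le_inf ((inf_le_inf_left a inf_le_left).trans hy) ((inf_le_inf_left a inf_le_right).trans hz)⟩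
  · rintro ⟨f, hf, h0⟩
    exact h f hf (le_antisymm h0 (le_inf ha (hF.prop.nonneg f hf)))
  · exact fun f hf => ⟨f, hf, inf_le_right⟩
  · obtain ⟨f, hf⟩ := hne
    exact ⟨f, hf, inf_le_left⟩

theorem mem_or_mem_of_sup_mem {a b : L} (ha : 0 ≤ a) (hb : 0 ≤ b) (h : a ⊔ b ∈ F) :
    a ∈ F ∨ b ∈ F := by
  by_contra! hab
  obtain ⟨f, hf, haf⟩ := exists_inf_eq_zero_of_notMem hF ha hab.1 ⟨_, h⟩
  obtain ⟨g, hg, hbg⟩ := exists_inf_eq_zero_of_notMem hF hb hab.2 ⟨_, h⟩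
  let _ := AddCommGroup.toDistribLattice L
  refine hF.prop.zero_notMem (hF.prop.mem_of_le _
    (hF.prop.inf_mem _ h _ (hF.prop.inf_mem _ hf _ hg)) _ ?_)
  have h1 : (a ⊔ b) ⊓ (f ⊓ g) = a ⊓ (f ⊓ g) ⊔ b ⊓ (f ⊓ g) := inf_sup_right _ _ _
  rw [h1]
  exact sup_le ((inf_le_inf_left a inf_le_left).trans haf.le)
    ((inf_le_inf_left b inf_le_right).trans hbg.le)

variable [Module ℝ L] [IsOrderedModule ℝ L]

theorem smul_mem_of_maximal {c : ℝ} (hc : 0 < c) {y : L} (hy : y ∈ F) : c • y ∈ F := by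
  have key : ∀ {c : ℝ}, 0 < c → c ≤ 1 → ∀ {y : L}, y ∈ F → c • y ∈ F := by
    intro c hc hc1 y hy
    -- For `c ≤ 1` the rescaled filter is proper and contains `F`, so by maximality it is contained
    -- in `F`.
    refine hF.le_of_ge (y := {z | c⁻¹ • z ∈ F}) ⟨?_, ?_, ?_, ?_⟩ ?_ ?_
    · intro z hz
      have := smul_nonneg hc.le (hF.prop.nonneg _ hz)
      rwa [smul_smul, mul_inv_cancel₀ hc.ne', one_smul] at this
    · intro z hz t hzt
      exact hF.prop.mem_of_le _ hz _ (smul_le_smul_of_nonneg_left hzt (inv_nonneg.2 hc.le))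
    · intro z hz t ht
      refine hF.prop.mem_of_le _ (hF.prop.inf_mem _ hz _ ht) _ ?_
      have := smul_sup_of_nonneg (inv_nonneg.2 hc.le) (-z) (-t)
      rw [← neg_inf, smul_neg, smul_neg, smul_neg, ← neg_inf, neg_inj] at this
      exact this.ge
    · intro h
      change c⁻¹ • (0 : L) ∈ F at h
      rw [smul_zero] at h
      exact hF.prop.zero_notMem h
    · intro z hz
      refine hF.prop.mem_of_le _ hz _ ?_
      have h1 : 1 ≤ c⁻¹ := (one_le_inv₀ hc).2 hc1
      simpa using smul_le_smul_of_nonneg_right h1 (hF.prop.nonneg _ hz)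
    · change c⁻¹ • c • y ∈ F
      rwa [smul_smul, inv_mul_cancel₀ hc.ne', one_smul]
  rcases le_total c 1 with h | h
  · exact key hc h hy
  · refine hF.prop.mem_of_le _ hy _ ?_
    simpa using smul_le_smul_of_nonneg_right h (hF.prop.nonneg _ hy)

end MaximalFilter

variable [Module ℝ L] [IsOrderedModule ℝ L]

/-- The cut of the reals defined by `y` modulo a filter: the `r` such that `r e < y` along `F`. -/
def filterCut (F : Set L) (e y : L) : Set ℝ := {r | (y - r • e) ⊔ 0 ∈ F}

/-! ### Cuts along a maximal filter and the lattice homomorphism they define -/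

section Cut

variable {F : Set L} (hF : Maximal IsProperNonnegFilter F) {e : L} (he : e ∈ F)
include hF

theorem filterCut_mono {y z : L} (h : y ≤ z) : filterCut F e y ⊆ filterCut F e z := fun _ hr =>
  hF.prop.mem_of_le _ hr _ (sup_le_sup_right (sub_le_sub_right h _) 0)

theorem add_mem_filterCut {y z : L} {r s : ℝ} (hr : r ∈ filterCut F e y)
    (hs : s ∈ filterCut F e z) : r + s ∈ filterCut F e (y + z) := by
  refine hF.prop.mem_of_le _ (hF.prop.inf_mem _ hr _ hs) _ ?_
  let _ := AddCommGroup.toDistribLattice L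
  have h1 : ((y - r • e) ⊔ 0) ⊓ ((z - s • e) ⊔ 0) = (y - r • e) ⊓ (z - s • e) ⊔ 0 :=
    (sup_inf_right _ _ _).symm
  have h2 : y + z - (r + s) • e = (y - r • e) + (z - s • e) := by
    rw [add_smul]
    abel
  rw [h1, h2]
  set a := y - r • e
  set b := z - s • e
  calc a ⊓ b ⊔ 0 ≤ (a ⊓ b ⊔ 0) + (a ⊓ b ⊔ 0) := le_add_of_nonneg_right le_sup_right
    _ = (a ⊓ b + a ⊓ b) ⊔ 0 := by
      rw [← two_smul ℝ, smul_sup_of_nonneg zero_le_two, smul_zero, two_smul]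
    _ ≤ (a + b) ⊔ 0 := sup_le_sup_right (add_le_add inf_le_left inf_le_right) 0

theorem smul_mem_filterCut {y : L} {r c : ℝ} (hc : 0 < c) (hr : r ∈ filterCut F e y) :
    c * r ∈ filterCut F e (c • y) := by
  have := smul_mem_of_maximal hF hc hr
  rwa [smul_sup_of_nonneg hc.le, smul_zero, smul_sub, smul_smul] at this

include he

theorem nonneg_unit : 0 ≤ e := hF.prop.nonneg _ he

theorem mem_filterCut_of_lt {y : L} {r c : ℝ} (h : c • e ≤ y) (hr : r < c) :
    r ∈ filterCut F e y := by
  refine hF.prop.mem_of_le _ (smul_mem_of_maximal hF (sub_pos.2 hr) he) _ ?_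
  rw [sub_smul]
  exact (sub_le_sub_right h _).trans le_sup_left

theorem lt_of_mem_filterCut {y : L} {r c : ℝ} (h : y ≤ c • e) (hr : r ∈ filterCut F e y) :
    r < c := by
  by_contra! hcr
  refine hF.prop.zero_notMem (hF.prop.mem_of_le _ hr _ (sup_le ?_ le_rfl))
  rw [sub_nonpos]
  exact h.trans (smul_le_smul_of_nonneg_right hcr (nonneg_unit hF he))

/-- The positive parts of `y - r • e` and `r' • e - y` add up to at least `(r' - r) • e`, so their
supremum is at least half of it and lies in `F`; primeness selects one. -/
theorem mem_filterCut_or_mem {r r' : ℝ} (h : r < r') (y : L) :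
    r ∈ filterCut F e y ∨ -r' ∈ filterCut F e (-y) := by
  refine mem_or_mem_of_sup_mem hF le_sup_right le_sup_right ?_
  refine hF.prop.mem_of_le _ (smul_mem_of_maximal hF (half_pos (sub_pos.2 h)) he) _ ?_
  set a := (y - r • e) ⊔ 0
  set b := (-y - -r' • e) ⊔ 0
  have h1 : (r' - r) • e ≤ (2 : ℝ) • (a ⊔ b) := by
    calc (r' - r) • e = (y - r • e) + (-y - -r' • e) := by
          rw [sub_smul, neg_smul]
          abel
      _ ≤ a + b := add_le_add le_sup_left le_sup_left
      _ ≤ (a ⊔ b) + (a ⊔ b) := add_le_add le_sup_left le_sup_right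
      _ = _ := (two_smul ℝ _).symm
  have h2 := smul_le_smul_of_nonneg_left h1 (by norm_num : (0 : ℝ) ≤ 2⁻¹)
  rw [smul_smul, smul_smul] at h2
  rw [inv_mul_cancel₀ two_ne_zero, one_smul] at h2
  rwa [div_eq_inv_mul]

end Cut

/-- The real lattice homomorphisms on `L` which take the value `1` at `e`. -/
def latticeCharacters (e : L) : Set (L → ℝ) :=
  {φ | φ e = 1 ∧ (∀ x y, φ (x + y) = φ x + φ y) ∧ (∀ (c : ℝ) x, φ (c • x) = c * φ x) ∧
    ∀ x y, φ (x ⊔ y) = φ x ⊔ φ y}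

theorem sSup_filterCut_mem_latticeCharacters {F : Set L} (hF : Maximal IsProperNonnegFilter F)
    {e : L} (he : e ∈ F) (hunit : ∀ x : L, ∃ c : ℝ, |x| ≤ c • e) :
    (fun y => sSup (filterCut F e y)) ∈ latticeCharacters e := by
  have hbdd : ∀ y, BddAbove (filterCut F e y) := fun y => by
    obtain ⟨c, hc⟩ := hunit y
    exact ⟨c, fun r hr => (lt_of_mem_filterCut hF he ((le_abs_self y).trans hc) hr).le⟩
  have hne : ∀ y, (filterCut F e y).Nonempty := fun y => by
    obtain ⟨c, hc⟩ := hunit y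
    refine ⟨-c - 1, mem_filterCut_of_lt hF he (c := -c) ?_ (by linarith)⟩
    rw [neg_smul, neg_le]
    exact (neg_le_abs y).trans hc
  set φ : L → ℝ := fun y => sSup (filterCut F e y) with hφ
  have hle : ∀ {y r}, r ∈ filterCut F e y → r ≤ φ y := fun hr => le_csSup (hbdd _) hr
  have hlt : ∀ {y r}, r < φ y → ∃ s ∈ filterCut F e y, r < s := fun hr =>
    exists_lt_of_lt_csSup (hne _) hr
  have hsuper : ∀ y z, φ y + φ z ≤ φ (y + z) := by
    intro y z
    by_contra! h
    obtain ⟨s, hs, hs'⟩ := hlt (show φ (y + z) - φ z < φ y by linarith)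
    obtain ⟨t, ht, ht'⟩ := hlt (show φ (y + z) - s < φ z by linarith)
    have := hle (add_mem_filterCut hF hs ht)
    linarith
  have hzero : φ 0 ≤ 0 :=
    csSup_le (hne 0) fun r hr => (lt_of_mem_filterCut hF he (c := 0) (by simp) hr).le
  have hodd : ∀ y, φ (-y) = -φ y := by
    intro y
    have h1 := hsuper y (-y)
    rw [add_neg_cancel] at h1
    by_contra hne
    -- Two reals `r < r'` in this gap would contradict `mem_filterCut_or_mem`.
    have h2 : φ y < -φ (-y) := lt_of_le_of_ne (by linarith) fun h => hne (by linarith)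
    obtain ⟨r, hr, hr'⟩ := exists_between h2
    obtain ⟨r', hrr', hr''⟩ := exists_between hr'
    rcases mem_filterCut_or_mem hF he hrr' y with h | h
    · exact absurd (hle h) hr.not_ge
    · have := hle h
      linarith
  have hsmul : ∀ c : ℝ, 0 < c → ∀ y, c * φ y ≤ φ (c • y) := by
    intro c hc y
    by_contra! h
    obtain ⟨s, hs, hs'⟩ := hlt (show φ (c • y) / c < φ y by rwa [div_lt_iff₀' hc])
    rw [div_lt_iff₀' hc] at hs'
    exact (hle (smul_mem_filterCut hF hc hs)).not_gt hs'
  have hsmul' : ∀ c : ℝ, 0 < c → ∀ y, φ (c • y) = c * φ y := by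
    intro c hc y
    refine le_antisymm ?_ (hsmul c hc y)
    have := hsmul c⁻¹ (inv_pos.2 hc) (c • y)
    rwa [smul_smul, inv_mul_cancel₀ hc.ne', one_smul, inv_mul_le_iff₀ hc] at this
  have hmono : ∀ {y z}, y ≤ z → φ y ≤ φ z := fun h =>
    csSup_le_csSup (hbdd _) (hne _) (filterCut_mono hF h)
  refine ⟨le_antisymm ?_ ?_, fun y z => le_antisymm ?_ (hsuper y z), fun c y => ?_,
    fun y z => le_antisymm ?_ (sup_le (hmono le_sup_left) (hmono le_sup_right))⟩
  · exact csSup_le (hne e) fun r hr => (lt_of_mem_filterCut hF he (c := 1) (by simp) hr).le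
  · refine le_of_forall_lt fun r hr => ?_
    obtain ⟨s, hs, hs'⟩ := exists_between hr
    exact hs.trans_le (hle (mem_filterCut_of_lt hF he (c := 1) (by simp) hs'))
  · have := hsuper (-y) (-z)
    rw [← neg_add, hodd, hodd, hodd] at this
    linarith
  · rcases lt_trichotomy c 0 with hc | rfl | hc
    · have := hsmul' (-c) (neg_pos.2 hc) y
      rw [neg_smul, hodd] at this
      linarith
    · have h0 := hodd 0
      rw [neg_zero] at h0
      rw [zero_smul, zero_mul]
      linarith
    · exact hsmul' c hc y
  · refine csSup_le (hne _) fun r hr => ?_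
    have h1 : (y - r • e) ⊔ 0 ⊔ ((z - r • e) ⊔ 0) ∈ F := by
      rwa [← sup_sup_distrib_right, ← sup_sub]
    rcases mem_or_mem_of_sup_mem hF le_sup_right le_sup_right h1 with h | h
    · exact (hle h).trans le_sup_left
    · exact (hle h).trans le_sup_right

/-- Some `n • x` is not below `e`. A maximal filter containing `(n • x - e) ⊔ 0` puts `1 / n` in the
cut of `x`, so the value at `x` is at least `1 / n`. -/
theorem exists_latticeCharacter_ne_zero (hL : IsArchimedeanLattice L) {e : L} (he0 : 0 ≤ e)
    (hunit : ∀ x : L, ∃ c : ℝ, |x| ≤ c • e) {x : L} (hx : 0 ≤ x) (hx0 : x ≠ 0) :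
    ∃ φ ∈ latticeCharacters e, φ x ≠ 0 := by
  obtain ⟨n, hn⟩ : ∃ n : ℕ, ¬ n • x ≤ e := by
    by_contra! h
    exact hx0 (hL x e hx h)
  have hn0 : (0 : ℝ) < n := by
    rw [Nat.cast_pos, Nat.pos_iff_ne_zero]
    rintro rfl
    exact hn (by simpa using he0)
  have hu : (n • x - e) ⊔ 0 ≠ 0 := fun h => hn (sub_nonpos.1 (le_sup_left.trans h.le))
  obtain ⟨F, huF, hF⟩ := exists_maximal_isProperNonnegFilter le_sup_right hu
  have he : e ∈ F := by
    obtain ⟨c, hc⟩ := hunit ((n • x - e) ⊔ 0)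
    have h1 : (n • x - e) ⊔ 0 ≤ (|c| + 1) • e := by
      refine (le_abs_self _).trans (hc.trans (smul_le_smul_of_nonneg_right ?_ he0))
      linarith [le_abs_self c]
    have hc0 : 0 < |c| + 1 := by positivity
    have := smul_mem_of_maximal hF (inv_pos.2 hc0) (hF.prop.mem_of_le _ huF _ h1)
    rwa [smul_smul, inv_mul_cancel₀ hc0.ne', one_smul] at this
  refine ⟨_, sSup_filterCut_mem_latticeCharacters hF he hunit, ?_⟩
  have hmem : (n : ℝ)⁻¹ ∈ filterCut F e x := by
    have := smul_mem_of_maximal hF (inv_pos.2 hn0) huF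
    rwa [smul_sup_of_nonneg (inv_nonneg.2 hn0.le), smul_zero, smul_sub,
      ← Nat.cast_smul_eq_nsmul ℝ, smul_smul, inv_mul_cancel₀ hn0.ne', one_smul] at this
  obtain ⟨c, hc⟩ := hunit x
  have hbdd : BddAbove (filterCut F e x) :=
    ⟨c, fun r hr => (lt_of_mem_filterCut hF he ((le_abs_self x).trans hc) hr).le⟩
  exact ((inv_pos.2 hn0).trans_le (le_csSup hbdd hmem)).ne'

/-- A closed subset of the product of the intervals `[-c x, c x]`. -/
theorem isCompact_latticeCharacters {e : L} (hunit : ∀ x : L, ∃ c : ℝ, |x| ≤ c • e) :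
    IsCompact (latticeCharacters e) := by
  choose c hc using hunit
  have heq : latticeCharacters e = {φ | φ e = 1} ∩ ((⋂ (x) (y), {φ | φ (x + y) = φ x + φ y}) ∩
      ((⋂ (c : ℝ) (x), {φ | φ (c • x) = c * φ x}) ∩ ⋂ (x) (y), {φ | φ (x ⊔ y) = φ x ⊔ φ y})) := by
    ext φ
    simp [latticeCharacters]
  refine IsCompact.of_isClosed_subset (isCompact_univ_pi fun x => isCompact_Icc (a := -c x)
    (b := c x)) ?_ ?_
  · rw [heq]
    refine IsClosed.inter (isClosed_eq (by fun_prop) (by fun_prop)) (IsClosed.inter ?_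
      (IsClosed.inter ?_ ?_))
    · exact isClosed_iInter fun x => isClosed_iInter fun y =>
        isClosed_eq (by fun_prop) (by fun_prop)
    · exact isClosed_iInter fun c => isClosed_iInter fun x =>
        isClosed_eq (by fun_prop) (by fun_prop)
    · exact isClosed_iInter fun x => isClosed_iInter fun y =>
        isClosed_eq (by fun_prop) ((continuous_apply x).sup (continuous_apply y))
  · rintro φ ⟨h1, h2, h3, h4⟩ x -
    let T : L →+ ℝ := AddMonoidHom.mk' φ h2
    have habs : |φ x| ≤ c x := by
      have := monotone_of_map_sup (T := T) h4 (hc x)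
      rw [map_abs_of_map_sup (T := T) h4] at this
      exact this.trans_eq ((h3 _ _).trans (by rw [h1, mul_one]))
    exact abs_le.1 habs

/-- The Yosida space: the real lattice homomorphisms taking the value `1` at `e`, with the topology
of pointwise convergence. -/
abbrev YosidaSpace (e : L) : Type u := latticeCharacters e

namespace YosidaSpace

variable {e : L}

/-- A point of the Yosida space as an additive map. -/
def toAddMonoidHom (φ : YosidaSpace e) : L →+ ℝ := AddMonoidHom.mk' φ.1 φ.2.2.1

theorem map_unit (φ : YosidaSpace e) : φ.toAddMonoidHom e = 1 := φ.2.1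

theorem map_smul (φ : YosidaSpace e) (c : ℝ) (x : L) :
    φ.toAddMonoidHom (c • x) = c * φ.toAddMonoidHom x := φ.2.2.2.1 c x

theorem map_sup (φ : YosidaSpace e) (x y : L) :
    φ.toAddMonoidHom (x ⊔ y) = φ.toAddMonoidHom x ⊔ φ.toAddMonoidHom y := φ.2.2.2.2 x y

theorem map_inf (φ : YosidaSpace e) (x y : L) :
    φ.toAddMonoidHom (x ⊓ y) = φ.toAddMonoidHom x ⊓ φ.toAddMonoidHom y :=
  map_inf_of_map_sup φ.map_sup x y

theorem map_abs (φ : YosidaSpace e) (x : L) : φ.toAddMonoidHom |x| = |φ.toAddMonoidHom x| :=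
  map_abs_of_map_sup φ.map_sup x

theorem monotone (φ : YosidaSpace e) : Monotone φ.toAddMonoidHom := monotone_of_map_sup φ.map_sup

theorem nonneg (φ : YosidaSpace e) {x : L} (hx : 0 ≤ x) : 0 ≤ φ.toAddMonoidHom x := by
  simpa using φ.monotone hx

theorem continuous_eval (x : L) : Continuous fun φ : YosidaSpace e => φ.toAddMonoidHom x :=
  (continuous_apply x).comp continuous_subtype_val

/-- An element of `L` as a continuous function on the Yosida space. -/
def eval (e x : L) : C(YosidaSpace e, ℝ) := ⟨fun φ => φ.toAddMonoidHom x, continuous_eval x⟩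

theorem eval_apply (x : L) (φ : YosidaSpace e) : eval e x φ = φ.toAddMonoidHom x := rfl

theorem compactSpace (hunit : ∀ x : L, ∃ c : ℝ, |x| ≤ c • e) : CompactSpace (YosidaSpace e) :=
  isCompact_iff_compactSpace.1 (isCompact_latticeCharacters hunit)

theorem le_of_forall_le (hL : IsArchimedeanLattice L) (he : 0 ≤ e)
    (hunit : ∀ x : L, ∃ c : ℝ, |x| ≤ c • e) {x y : L}
    (h : ∀ φ : YosidaSpace e, φ.toAddMonoidHom x ≤ φ.toAddMonoidHom y) : x ≤ y := by
  by_contra hxy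
  have hne : (x - y) ⊔ 0 ≠ 0 := fun h => hxy (sub_nonpos.1 (le_sup_left.trans h.le))
  obtain ⟨φ, hφ, hφ'⟩ := exists_latticeCharacter_ne_zero hL he hunit le_sup_right hne
  refine hφ' ?_
  change toAddMonoidHom ⟨φ, hφ⟩ ((x - y) ⊔ 0) = 0
  rw [map_sup, map_sub, map_zero]
  exact sup_eq_right.2 (sub_nonpos.2 (h _))

theorem exists_abs_eval_sub_lt (hunit : ∀ x : L, ∃ c : ℝ, |x| ≤ c • e) (f : C(YosidaSpace e, ℝ))
    {ε : ℝ} (hε : 0 < ε) : ∃ x : L, ∀ φ : YosidaSpace e, |φ.toAddMonoidHom x - f φ| < ε := by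
  have := compactSpace hunit
  have htop : closure (Set.range (eval e)) = ⊤ := by
    refine ContinuousMap.sublattice_closure_eq_top _ (Set.range_nonempty _) ?_ ?_ ?_
    · rintro _ ⟨x, rfl⟩ _ ⟨y, rfl⟩
      exact ⟨x ⊓ y, ContinuousMap.ext fun φ => φ.map_inf x y⟩
    · rintro _ ⟨x, rfl⟩ _ ⟨y, rfl⟩
      exact ⟨x ⊔ y, ContinuousMap.ext fun φ => φ.map_sup x y⟩
    · intro v φ ψ
      by_cases hφψ : φ = ψ
      · subst hφψ
        refine ⟨_, ⟨v φ • e, rfl⟩, ?_, ?_⟩ <;> rw [eval_apply, map_smul, map_unit, mul_one]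
      · obtain ⟨x, hx⟩ : ∃ x, φ.toAddMonoidHom x ≠ ψ.toAddMonoidHom x := by
          by_contra! h
          exact hφψ (Subtype.ext (funext h))
        have hx' := sub_ne_zero.2 hx
        -- The affine interpolation in `e` and `x` with prescribed values at `φ` and `ψ`.
        refine ⟨_, ⟨(v φ - (v φ - v ψ) / (φ.toAddMonoidHom x - ψ.toAddMonoidHom x) *
          φ.toAddMonoidHom x) • e +
          ((v φ - v ψ) / (φ.toAddMonoidHom x - ψ.toAddMonoidHom x)) • x, rfl⟩, ?_, ?_⟩
        · rw [eval_apply, map_add, map_smul, map_smul, map_unit]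
          ring
        · rw [eval_apply, map_add, map_smul, map_smul, map_unit]
          field_simp
          ring
  have hf : f ∈ closure (Set.range (eval e)) := by
    rw [htop]
    trivial
  obtain ⟨_, ⟨x, rfl⟩, hx⟩ := Metric.mem_closure_iff.1 hf ε hε
  refine ⟨x, fun φ => ?_⟩
  rw [dist_comm] at hx
  exact (ContinuousMap.dist_apply_le_dist φ).trans_lt hx

theorem exists_bump (hunit : ∀ x : L, ∃ c : ℝ, |x| ≤ c • e) {V : Set (YosidaSpace e)}
    (hV : IsOpen V) (hne : V.Nonempty) :
    ∃ y : L, 0 ≤ y ∧ y ≠ 0 ∧ (∀ φ : YosidaSpace e, φ.toAddMonoidHom y ≤ 1) ∧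
      ∀ φ ∉ V, φ.toAddMonoidHom y = 0 := by
  have := compactSpace hunit
  obtain ⟨p, hp⟩ := hne
  obtain ⟨h, h0, h1, h01⟩ := exists_continuous_zero_one_of_isClosed hV.isClosed_compl
    (isClosed_singleton (x := p)) (Set.disjoint_singleton_right.2 fun h => h hp)
  -- Subtracting the error `1/4` and taking the positive part gives exact vanishing off `V` and
  -- keeps the values at most 1, with more than `1/2` left at `p`.
  obtain ⟨x, hx⟩ := exists_abs_eval_sub_lt hunit h (by norm_num : (0 : ℝ) < 1 / 4)
  have hval : ∀ φ : YosidaSpace e, φ.toAddMonoidHom ((x - (1 / 4 : ℝ) • e) ⊔ 0) =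
      (φ.toAddMonoidHom x - 1 / 4) ⊔ 0 := fun φ => by
    rw [map_sup, map_sub, map_smul, map_unit, map_zero, mul_one]
  refine ⟨(x - (1 / 4 : ℝ) • e) ⊔ 0, le_sup_right, fun h => ?_, fun φ => ?_, fun φ hφ => ?_⟩
  · have h2 := hval p
    rw [h, map_zero] at h2
    have h3 := (le_sup_left : _ ≤ (p.toAddMonoidHom x - 1 / 4) ⊔ 0).trans_eq h2.symm
    have h4 := (abs_lt.1 (hx p)).1
    have h5 := h1 (Set.mem_singleton p)
    simp only [Pi.one_apply] at h5
    linarith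
  · rw [hval]
    have := (abs_lt.1 (hx φ)).2
    exact sup_le (by linarith [(h01 φ).2]) zero_le_one
  · rw [hval]
    have h2 := (abs_lt.1 (hx φ)).2
    have h3 := h0 hφ
    simp only [Pi.zero_apply] at h3
    exact sup_eq_right.2 (by linarith)

end YosidaSpace

end Yosida

/-! ### The representation of a band with a weak unit -/

section PrincipalIdeal

variable {E : Type u} [Lattice E] [AddCommGroup E] [IsOrderedAddMonoid E] [Module ℝ E]
  [IsOrderedModule ℝ E]

/-- The ideal generated by an element `e`. -/
def principalIdeal (e : E) : Submodule ℝ E where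
  carrier := {x | ∃ c : ℝ, |x| ≤ c • e}
  zero_mem' := ⟨0, by simp⟩
  add_mem' := by
    rintro x y ⟨c, hc⟩ ⟨d, hd⟩
    exact ⟨c + d, (abs_add_le x y).trans (by rw [add_smul]; exact add_le_add hc hd)⟩
  smul_mem' := by
    rintro c x ⟨d, hd⟩
    exact ⟨|c| * d, (abs_real_smul_le c x).trans
      (by rw [mul_smul]; exact smul_le_smul_of_nonneg_left hd (abs_nonneg c))⟩

theorem mem_principalIdeal_of_abs_le {e x y : E} (h : |x| ≤ |y|) (hy : y ∈ principalIdeal e) :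
    x ∈ principalIdeal e := hy.imp fun _ hc => h.trans hc

theorem sup_mem_principalIdeal {e : E} {x y : E} (hx : x ∈ principalIdeal e)
    (hy : y ∈ principalIdeal e) : x ⊔ y ∈ principalIdeal e := by
  obtain ⟨c, hc⟩ := hx
  obtain ⟨d, hd⟩ := hy
  refine ⟨c + d, ?_⟩
  rw [add_smul]
  refine le_trans ?_ (add_le_add hc hd)
  rw [abs_le']
  refine ⟨sup_le ((le_abs_self x).trans (le_add_of_nonneg_right (abs_nonneg y)))
    ((le_abs_self y).trans (le_add_of_nonneg_left (abs_nonneg x))), ?_⟩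
  exact (neg_le_neg le_sup_left).trans ((neg_le_abs x).trans
    (le_add_of_nonneg_right (abs_nonneg y)))

theorem inf_mem_principalIdeal {e : E} {x y : E} (hx : x ∈ principalIdeal e)
    (hy : y ∈ principalIdeal e) : x ⊓ y ∈ principalIdeal e := by
  have := neg_mem (sup_mem_principalIdeal (neg_mem hx) (neg_mem hy))
  rwa [neg_sup, neg_neg, neg_neg] at this

variable {e : E}

instance principalIdeal.instLattice : Lattice (principalIdeal e) :=
  Subtype.lattice (fun _ _ => sup_mem_principalIdeal) (fun _ _ => inf_mem_principalIdeal)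

instance principalIdeal.instIsOrderedAddMonoid : IsOrderedAddMonoid (principalIdeal e) where
  add_le_add_left a b h c := add_le_add_left (show (a : E) ≤ b from h) (c : E)

instance principalIdeal.instIsOrderedModule : IsOrderedModule ℝ (principalIdeal e) where
  smul_le_smul_of_nonneg_left c hc a b h :=
    show c • (a : E) ≤ c • (b : E) from
      smul_le_smul_of_nonneg_left (show (a : E) ≤ b from h) hc
  smul_le_smul_of_nonneg_right a ha c d h :=
    show c • (a : E) ≤ d • (a : E) from
      smul_le_smul_of_nonneg_right h (show (0 : E) ≤ a from ha)

theorem principalIdeal.isArchimedeanLattice (hE : IsArchimedeanLattice E) :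
    IsArchimedeanLattice (principalIdeal e) := fun x y hx h =>
  Subtype.ext (hE x y hx fun n => by simpa using (show ((n • x : principalIdeal e) : E) ≤ y from h n))

theorem self_mem_principalIdeal (he : 0 ≤ e) : e ∈ principalIdeal e :=
  ⟨1, by rw [one_smul, abs_of_nonneg he]⟩

/-- The generator of a principal ideal, as an element of the ideal. -/
def idealUnit (he : 0 ≤ e) : principalIdeal e := ⟨e, self_mem_principalIdeal he⟩

theorem exists_abs_le_smul_idealUnit (he : 0 ≤ e) (x : principalIdeal e) :
    ∃ c : ℝ, |x| ≤ c • idealUnit he := x.2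

/-- The part `|x| ⊓ e` of an element, as an element of the ideal generated by `e`. -/
def absInfUnit (he : 0 ≤ e) (x : E) : principalIdeal e :=
  ⟨|x| ⊓ e, mem_principalIdeal_of_abs_le
    (by rw [abs_of_nonneg (le_inf (abs_nonneg x) he), abs_of_nonneg he]; exact inf_le_right)
    (self_mem_principalIdeal he)⟩

variable {he : 0 ≤ e}

theorem absInfUnit_mono {x y : E} (h : |x| ≤ |y|) : absInfUnit he x ≤ absInfUnit he y :=
  show |x| ⊓ e ≤ |y| ⊓ e from inf_le_inf_right e h

theorem absInfUnit_nonneg (x : E) : 0 ≤ absInfUnit he x :=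
  show (0 : E) ≤ |x| ⊓ e from le_inf (abs_nonneg x) he

theorem absInfUnit_add_le (x y : E) :
    absInfUnit he (x + y) ≤ absInfUnit he x + absInfUnit he y := by
  change |x + y| ⊓ e ≤ |x| ⊓ e + |y| ⊓ e
  refine (inf_le_inf_right e (abs_add_le x y)).trans ?_
  rw [inf_comm, inf_comm |x|, inf_comm |y|]
  exact inf_add_le_inf_add_inf he (abs_nonneg x) (abs_nonneg y)

theorem absInfUnit_coe (y : principalIdeal e) : absInfUnit he y = |y| ⊓ idealUnit he := rfl

/-- The elements of `E` which vanish at a point of the Yosida space of the ideal generated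
by `e`. -/
def nullIdeal (φ : YosidaSpace (idealUnit he)) : Submodule ℝ E where
  carrier := {x | φ.toAddMonoidHom (absInfUnit he x) = 0}
  zero_mem' := by
    have : absInfUnit he (0 : E) = 0 := Subtype.ext (by
      change |(0 : E)| ⊓ e = 0
      rw [abs_zero, inf_eq_left.2 he])
    rw [Set.mem_ofPred_eq, this, map_zero]
  add_mem' {x y} hx hy := by
    refine le_antisymm ((φ.monotone (absInfUnit_add_le x y)).trans ?_)
      (φ.nonneg (absInfUnit_nonneg _))
    rw [map_add]
    exact (congrArg₂ (· + ·) hx hy).le.trans (by simp)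
  smul_mem' c x hx := by
    -- Subadditivity handles integer multiples, and these dominate real ones.
    have hn : ∀ n : ℕ, φ.toAddMonoidHom (absInfUnit he (n • |x|)) ≤ 0 := by
      intro n
      induction n with
      | zero =>
        rw [zero_smul]
        refine (φ.monotone (absInfUnit_mono (y := x) ?_)).trans (le_of_eq hx)
        simp
      | succ n ih =>
        rw [succ_nsmul]
        refine (φ.monotone (absInfUnit_add_le _ _)).trans ?_
        rw [map_add]
        refine add_nonpos ih ((φ.monotone (absInfUnit_mono (y := x) ?_)).trans (le_of_eq hx))
        rw [abs_of_nonneg (abs_nonneg x)]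
    obtain ⟨n, hn'⟩ := exists_nat_ge |c|
    refine le_antisymm ((φ.monotone (absInfUnit_mono ?_)).trans (hn n))
      (φ.nonneg (absInfUnit_nonneg _))
    rw [abs_of_nonneg (nsmul_nonneg (abs_nonneg x) n)]
    exact (abs_real_smul_le c x).trans (real_smul_le_nsmul (abs_nonneg x) hn')

theorem mem_nullIdeal {φ : YosidaSpace (idealUnit he)} {x : E} :
    x ∈ nullIdeal φ ↔ φ.toAddMonoidHom (absInfUnit he x) = 0 := Iff.rfl

theorem mem_nullIdeal_of_abs_le {φ : YosidaSpace (idealUnit he)} {x y : E} (h : |x| ≤ |y|)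
    (hy : y ∈ nullIdeal φ) : x ∈ nullIdeal φ :=
  le_antisymm ((φ.monotone (absInfUnit_mono h)).trans (le_of_eq hy))
    (φ.nonneg (absInfUnit_nonneg _))

/-- The null ideal extends the kernel of `φ` without enlarging it; this makes the value of an
element of `E` independent of the chosen representative. -/
theorem coe_mem_nullIdeal {φ : YosidaSpace (idealUnit he)} {y : principalIdeal e} :
    (y : E) ∈ nullIdeal φ ↔ φ.toAddMonoidHom y = 0 := by
  rw [mem_nullIdeal, absInfUnit_coe, φ.map_inf, φ.map_unit, φ.map_abs]
  constructor
  · intro h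
    rcases min_choice |φ.toAddMonoidHom y| 1 with h1 | h1
    · exact abs_eq_zero.1 (h1.symm.trans h)
    · exact absurd (h1.symm.trans h) one_ne_zero
  · intro h
    rw [h, abs_zero]
    exact inf_eq_left.2 zero_le_one

theorem sup_sub_sup_mem_nullIdeal {φ : YosidaSpace (idealUnit he)} {x y a b : E}
    (hx : x - a ∈ nullIdeal φ) (hy : y - b ∈ nullIdeal φ) : x ⊔ y - a ⊔ b ∈ nullIdeal φ := by
  have h1 : x ⊔ y - a ⊔ y ∈ nullIdeal φ :=
    mem_nullIdeal_of_abs_le (abs_sup_sub_sup_le_abs x a y) hx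
  have h2 : a ⊔ y - a ⊔ b ∈ nullIdeal φ := by
    rw [sup_comm a y, sup_comm a b]
    exact mem_nullIdeal_of_abs_le (abs_sup_sub_sup_le_abs y b a) hy
  simpa using add_mem h1 h2

/-- The excess `(x - n • e) ⊔ 0` is disjoint from `(n • e - x) ⊔ 0 = n • e - y`, which is positive
at `φ`, so the excess is null there. -/
theorem sub_inf_mem_nullIdeal {φ : YosidaSpace (idealUnit he)} {x : E} {n : ℕ}
    {y : principalIdeal e} (hy : (y : E) = x ⊓ n • e) (h : φ.toAddMonoidHom y < n) :
    x - (y : E) ∈ nullIdeal φ := by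
  have hdisj : absInfUnit he (x - (y : E)) ⊓ (n • idealUnit he - y) = 0 := by
    apply Subtype.ext
    change |x - (y : E)| ⊓ e ⊓ (n • e - (y : E)) = 0
    have h1 : x - (y : E) = (x - n • e) ⊔ 0 := by rw [hy, sub_inf_eq_sub_sup_zero]
    have h2 : n • e - (y : E) = (n • e - x) ⊔ 0 := by rw [hy, inf_comm, sub_inf_eq_sub_sup_zero]
    rw [h1, h2, abs_of_nonneg le_sup_right]
    exact inf_eq_zero_of_le (le_inf le_sup_right he) le_sup_right inf_le_left le_rfl
      (sub_sup_zero_inf_sub_sup_zero_swap _ _)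
  have hφ := congrArg φ.toAddMonoidHom hdisj
  rw [φ.map_inf, map_sub, map_nsmul, φ.map_unit, map_zero, nsmul_eq_mul, mul_one] at hφ
  rw [mem_nullIdeal]
  rcases min_choice (φ.toAddMonoidHom (absInfUnit he (x - (y : E))))
    ((n : ℝ) - φ.toAddMonoidHom y) with h1 | h1
  · exact h1.symm.trans hφ
  · have := h1.symm.trans hφ
    linarith

open Classical in
/-- The value of an element of `E` at a point of the Yosida space: it is the value of any element
of the ideal generated by `e` with the same residue, if there is one. -/
noncomputable def yosidaValue (φ : YosidaSpace (idealUnit he)) (x : E) : ℝ :=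
  -- The default 0 is never taken on `regularSet`, which is open and, for Archimedean `E`, dense, so
  -- it does not affect the class in `S(X)`.
  if h : ∃ y : principalIdeal e, x - (y : E) ∈ nullIdeal φ then φ.toAddMonoidHom h.choose else 0

theorem yosidaValue_eq {φ : YosidaSpace (idealUnit he)} {x : E} {y : principalIdeal e}
    (h : x - (y : E) ∈ nullIdeal φ) : yosidaValue φ x = φ.toAddMonoidHom y := by
  have hex : ∃ y : principalIdeal e, x - (y : E) ∈ nullIdeal φ := ⟨y, h⟩
  rw [yosidaValue, dif_pos hex, ← sub_eq_zero, ← map_sub, ← coe_mem_nullIdeal]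
  have := sub_mem h hex.choose_spec
  rwa [sub_sub_sub_cancel_left] at this

theorem yosidaValue_coe (φ : YosidaSpace (idealUnit he)) (y : principalIdeal e) :
    yosidaValue φ (y : E) = φ.toAddMonoidHom y :=
  yosidaValue_eq (by rw [sub_self]; exact zero_mem _)

/-- The open set on which an element of `E` agrees locally with elements of the ideal generated
by `e`. -/
def regularSet (he : 0 ≤ e) (x : E) : Set (YosidaSpace (idealUnit he)) :=
  {φ | ∃ y : principalIdeal e, ∀ᶠ ψ in nhds φ, x - (y : E) ∈ nullIdeal ψ}

theorem isOpen_regularSet (x : E) : IsOpen (regularSet he x) := by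
  rw [isOpen_iff_mem_nhds]
  rintro φ ⟨y, hy⟩
  filter_upwards [eventually_eventually_nhds.2 hy] with ψ hψ using ⟨y, hψ⟩

theorem exists_of_mem_regularSet {φ : YosidaSpace (idealUnit he)} {x : E}
    (h : φ ∈ regularSet he x) : ∃ y : principalIdeal e, x - (y : E) ∈ nullIdeal φ :=
  h.imp fun _ hy => hy.self_of_nhds

theorem continuousOn_yosidaValue (x : E) :
    ContinuousOn (fun φ : YosidaSpace (idealUnit he) => yosidaValue φ x) (regularSet he x) := by
  rintro φ ⟨y, hy⟩
  refine ContinuousAt.continuousWithinAt ?_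
  refine (YosidaSpace.continuous_eval y).continuousAt.congr ?_
  filter_upwards [hy] with ψ hψ using (yosidaValue_eq hψ).symm

theorem inter_regularSet_subset_add (x y : E) :
    regularSet he x ∩ regularSet he y ⊆ regularSet he (x + y) := by
  rintro φ ⟨⟨a, ha⟩, b, hb⟩
  refine ⟨a + b, ?_⟩
  filter_upwards [ha, hb] with ψ h1 h2
  have := add_mem h1 h2
  rwa [← add_sub_add_comm] at this

theorem regularSet_subset_smul (c : ℝ) (x : E) : regularSet he x ⊆ regularSet he (c • x) := by
  rintro φ ⟨a, ha⟩
  refine ⟨c • a, ?_⟩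
  filter_upwards [ha] with ψ h1
  have := (nullIdeal ψ).smul_mem c h1
  rwa [smul_sub] at this

/-- On an open `V` missing the regular set, `x ⊓ n • e` has value at least `n` for every `n`. A bump
`y` living on `V` then satisfies `n • y ≤ x`, contradicting the Archimedean property. -/
theorem dense_regularSet_of_nonneg (hE : IsArchimedeanLattice E) {x : E} (hx : 0 ≤ x) :
    Dense (regularSet he x) := by
  rw [dense_iff_inter_open]
  intro V hV hne
  by_contra hdisj
  rw [Set.not_nonempty_iff_eq_empty] at hdisj
  obtain ⟨y, hy0, hy, hy1, hyV⟩ :=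
    YosidaSpace.exists_bump (exists_abs_le_smul_idealUnit he) hV hne
  refine hy (Subtype.ext (hE y x hy0 fun n => ?_))
  have hmem : x ⊓ n • e ∈ principalIdeal e := by
    refine mem_principalIdeal_of_abs_le (y := n • e) ?_
      (nsmul_mem (self_mem_principalIdeal he) n)
    rw [abs_of_nonneg (le_inf hx (nsmul_nonneg he n)), abs_of_nonneg (nsmul_nonneg he n)]
    exact inf_le_right
  have hle : n • y ≤ ⟨x ⊓ n • e, hmem⟩ := by
    refine YosidaSpace.le_of_forall_le (principalIdeal.isArchimedeanLattice hE) he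
      (exists_abs_le_smul_idealUnit he) fun φ => ?_
    rw [map_nsmul]
    by_cases hφ : φ ∈ V
    · have h1 : (n : ℝ) ≤ φ.toAddMonoidHom ⟨x ⊓ n • e, hmem⟩ := by
        by_contra! hlt
        have : φ ∈ V ∩ regularSet he x := by
          refine ⟨hφ, ⟨x ⊓ n • e, hmem⟩, ?_⟩
          filter_upwards [(YosidaSpace.continuous_eval ⟨x ⊓ n • e, hmem⟩).continuousAt.eventually
            (gt_mem_nhds hlt)] with ψ hψ using sub_inf_mem_nullIdeal rfl hψ
        rw [hdisj] at this
        exact this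
      refine le_trans ?_ h1
      rw [nsmul_eq_mul]
      exact mul_le_of_le_one_right (Nat.cast_nonneg n) (hy1 φ)
    · rw [hyV φ hφ, nsmul_zero]
      exact φ.nonneg (show (0 : E) ≤ x ⊓ n • e from le_inf hx (nsmul_nonneg he n))
  have hle' : ((n • y : principalIdeal e) : E) ≤ x ⊓ n • e := hle
  simpa using hle'.trans inf_le_left

theorem dense_regularSet (hE : IsArchimedeanLattice E) (x : E) : Dense (regularSet he x) := by
  refine ((dense_regularSet_of_nonneg hE (le_sup_right : 0 ≤ x ⊔ 0)).inter_of_isOpen_left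
    (dense_regularSet_of_nonneg hE (le_sup_right : 0 ≤ (-x) ⊔ 0))
    (isOpen_regularSet _)).mono ?_
  refine (Set.inter_subset_inter_right _ (regularSet_subset_smul (-1) _)).trans
    ((inter_regularSet_subset_add _ _).trans_eq ?_)
  rw [neg_one_smul, ← sub_eq_add_neg, sup_zero_add_sup_zero_neg]

/-- The representation of `E` on the Yosida space of the ideal generated by `e`. -/
noncomputable def yosidaRepresentation (hE : IsArchimedeanLattice E) (he : 0 ≤ e) :
    E →ₗ[ℝ] SX (YosidaSpace (idealUnit he)) where
  toFun x := SX.mk (fun φ => yosidaValue φ x) (regularSet he x) (isOpen_regularSet x)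
    (dense_regularSet hE x) (continuousOn_yosidaValue x)
  map_add' x y := by
    rw [(SX.rep_mk _ _ _ _ _).eq_iff ((SX.rep_mk _ _ _ _ _).add (SX.rep_mk _ _ _ _ _))]
    refine eventually_openDenseFilter ((isOpen_regularSet x).inter (isOpen_regularSet y))
      ((dense_regularSet hE x).inter_of_isOpen_left (dense_regularSet hE y)
        (isOpen_regularSet x)) ?_
    rintro φ ⟨hx, hy⟩
    obtain ⟨a, ha⟩ := exists_of_mem_regularSet hx
    obtain ⟨b, hb⟩ := exists_of_mem_regularSet hy
    have hab : x + y - ((a + b : principalIdeal e) : E) ∈ nullIdeal φ := by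
      have := add_mem ha hb
      rwa [← add_sub_add_comm] at this
    rw [yosidaValue_eq ha, yosidaValue_eq hb, yosidaValue_eq hab, map_add]
  map_smul' c x := by
    rw [RingHom.id_apply, (SX.rep_mk _ _ _ _ _).eq_iff ((SX.rep_mk _ _ _ _ _).smul c)]
    refine eventually_openDenseFilter (isOpen_regularSet x) (dense_regularSet hE x) ?_
    intro φ hx
    obtain ⟨a, ha⟩ := exists_of_mem_regularSet hx
    have hca : c • x - ((c • a : principalIdeal e) : E) ∈ nullIdeal φ := by
      have := (nullIdeal φ).smul_mem c ha
      rwa [smul_sub] at this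
    rw [yosidaValue_eq ha, yosidaValue_eq hca, φ.map_smul]

theorem rep_yosidaRepresentation (hE : IsArchimedeanLattice E) (he : 0 ≤ e) (x : E) :
    (yosidaRepresentation hE he x).Rep fun φ => yosidaValue φ x := rfl

theorem yosidaRepresentation_sup (hE : IsArchimedeanLattice E) (he : 0 ≤ e) (x y : E) :
    yosidaRepresentation hE he (x ⊔ y) =
      yosidaRepresentation hE he x ⊔ yosidaRepresentation hE he y := by
  rw [(rep_yosidaRepresentation hE he _).eq_iff
    ((rep_yosidaRepresentation hE he _).sup (rep_yosidaRepresentation hE he _))]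
  refine eventually_openDenseFilter ((isOpen_regularSet x).inter (isOpen_regularSet y))
    ((dense_regularSet hE x).inter_of_isOpen_left (dense_regularSet hE y)
      (isOpen_regularSet x)) ?_
  rintro φ ⟨hx, hy⟩
  obtain ⟨a, ha⟩ := exists_of_mem_regularSet hx
  obtain ⟨b, hb⟩ := exists_of_mem_regularSet hy
  have hab : x ⊔ y - ((a ⊔ b : principalIdeal e) : E) ∈ nullIdeal φ :=
    sup_sub_sup_mem_nullIdeal ha hb
  rw [yosidaValue_eq ha, yosidaValue_eq hb, yosidaValue_eq hab, φ.map_sup]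

theorem yosidaRepresentation_coe (hE : IsArchimedeanLattice E) (he : 0 ≤ e)
    (y : principalIdeal e) :
    yosidaRepresentation hE he (y : E) =
      SX.ofContinuous (YosidaSpace.eval (idealUnit he) y) := by
  rw [(rep_yosidaRepresentation hE he _).eq_iff (SX.rep_ofContinuous _)]
  exact Eventually.of_forall fun φ => yosidaValue_coe φ y

theorem yosidaRepresentation_unit (hE : IsArchimedeanLattice E) (he : 0 ≤ e) :
    yosidaRepresentation hE he e = SX.ofContinuous 1 := by
  refine (yosidaRepresentation_coe hE he (idealUnit he)).trans ?_
  congr 1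
  exact ContinuousMap.ext fun φ => φ.map_unit

theorem yosidaRepresentation_closure (hE : IsArchimedeanLattice E) (he : 0 ≤ e)
    (g : SX (YosidaSpace (idealUnit he))) :
    (∃ f : C(YosidaSpace (idealUnit he), ℝ), g = SX.ofContinuous f) ↔
      ∀ ε : ℝ, 0 < ε → ∃ x : E, (∃ c : ℝ, |x| ≤ c • e) ∧
        |yosidaRepresentation hE he x - g| ≤ ε • (SX.ofContinuous 1 : SX _) := by
  have := YosidaSpace.compactSpace (exists_abs_le_smul_idealUnit he)
  constructor
  · rintro ⟨f, rfl⟩ ε hε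
    obtain ⟨x, hx⟩ := YosidaSpace.exists_abs_eval_sub_lt (exists_abs_le_smul_idealUnit he) f hε
    refine ⟨x, x.2, ?_⟩
    rw [yosidaRepresentation_coe, SX.abs_ofContinuous_sub_le_iff]
    exact fun φ => (hx φ).le
  · intro h
    refine SX.exists_eq_ofContinuous fun ε hε => ?_
    obtain ⟨x, hx, hxg⟩ := h ε hε
    refine ⟨YosidaSpace.eval (idealUnit he) ⟨x, hx⟩, ?_⟩
    rwa [← yosidaRepresentation_coe hE he ⟨x, hx⟩]

theorem absInfUnit_eq_zero_of_yosidaRepresentation_eq_zero (hE : IsArchimedeanLattice E)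
    (he : 0 ≤ e) {x : E} (h : yosidaRepresentation hE he x = 0) : |x| ⊓ e = 0 := by
  let T : E →+ SX (YosidaSpace (idealUnit he)) := (yosidaRepresentation hE he).toAddMonoidHom
  have hT : ∀ x y, T (x ⊔ y) = T x ⊔ T y := yosidaRepresentation_sup hE he
  have h1 : T |x| = 0 := by
    rw [map_abs_of_map_sup hT, show T x = 0 from h, abs_zero]
  have h2 : T (|x| ⊓ e) ≤ T 0 := by
    rw [map_zero, ← h1]
    exact monotone_of_map_sup hT inf_le_left
  have h3 : absInfUnit he x ≤ 0 := by
    refine YosidaSpace.le_of_forall_le (principalIdeal.isArchimedeanLattice hE) he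
      (exists_abs_le_smul_idealUnit he) fun φ => ?_
    have h4 : SX.ofContinuous (YosidaSpace.eval (idealUnit he) (absInfUnit he x)) ≤
        SX.ofContinuous (YosidaSpace.eval (idealUnit he) 0) := by
      rw [← yosidaRepresentation_coe hE he, ← yosidaRepresentation_coe hE he]
      exact h2
    exact SX.ofContinuous_le_iff.1 h4 φ
  exact le_antisymm h3 (absInfUnit_nonneg (he := he) x)

theorem isWeakUnitRepresentation_yosidaRepresentation (hE : IsArchimedeanLattice E) (he : 0 ≤ e)
    {B : Submodule ℝ E} (hB : IsWeakUnitOf B e) :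
    IsWeakUnitRepresentation B e (yosidaRepresentation hE he) where
  injOn x hx y hy hxy := by
    refine sub_eq_zero.1 (hB.eq_zero _ (sub_mem hx hy)
      (absInfUnit_eq_zero_of_yosidaRepresentation_eq_zero hE he ?_))
    rw [map_sub, hxy, sub_self]
  map_unit := yosidaRepresentation_unit hE he
  closure_eq := yosidaRepresentation_closure hE he

theorem exists_isBandRepresentation (hE : IsArchimedeanLattice E) {ι : Type v}
    {B : ι → Submodule ℝ E} {e : ι → E} (h : IsBandDecomposition B e) :
    ∃ (Z : ι → Type u) (_ : ∀ i, TopologicalSpace (Z i)) (_ : ∀ i, CompactSpace (Z i))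
      (_ : ∀ i, T2Space (Z i)) (T : E →ₗ[ℝ] SX (Σ i, Z i)), IsBandRepresentation B e T := by
  have he : ∀ i, 0 ≤ e i := fun i => (h.weakUnit i).nonneg
  refine ⟨fun i => YosidaSpace (idealUnit (he i)), fun i => inferInstance,
    fun i => YosidaSpace.compactSpace (exists_abs_le_smul_idealUnit (he i)),
    fun i => inferInstance,
    SX.sigmaEquiv.symm.toLinearMap ∘ₗ LinearMap.pi fun i => yosidaRepresentation hE (he i),
    ?_, fun i => ?_⟩
  · intro x y
    refine SX.ext_component fun i => ?_
    rw [SX.component_sup]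
    simp only [LinearMap.comp_apply, LinearEquiv.coe_coe, SX.component_sigmaEquiv_symm,
      LinearMap.pi_apply]
    exact yosidaRepresentation_sup hE (he i) x y
  · convert isWeakUnitRepresentation_yosidaRepresentation hE (he i) (h.weakUnit i)
    ext1 x
    simp only [LinearMap.comp_apply, LinearEquiv.coe_coe, SX.component_sigmaEquiv_symm,
      LinearMap.pi_apply]

end PrincipalIdeal

/-! ### Properties of the representations -/

section Properties

variable {E : Type u} [Lattice E] [AddCommGroup E] [IsOrderedAddMonoid E] [Module ℝ E]
  [IsOrderedModule ℝ E] {ι : Type v} {B : ι → Submodule ℝ E} {e : ι → E}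
  {Z : ι → Type w} [∀ i, TopologicalSpace (Z i)] {T : E →ₗ[ℝ] SX (Σ i, Z i)}

theorem IsBandDecomposition.eq_zero_of_abs_inf_unit (h : IsBandDecomposition B e) {x : E}
    (hx : ∀ i, |x| ⊓ e i = 0) : x = 0 := by
  refine h.complete x fun i y hy => (h.weakUnit i).eq_zero _ ?_ ?_
  · refine (h.band i).solid _ y ?_ hy
    rw [abs_of_nonneg (le_inf (abs_nonneg x) (abs_nonneg y))]
    exact inf_le_right
  · rw [abs_of_nonneg (le_inf (abs_nonneg x) (abs_nonneg y))]
    exact inf_eq_zero_of_le (le_inf (abs_nonneg x) (abs_nonneg y)) (h.weakUnit i).nonneg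
      inf_le_left le_rfl (hx i)

theorem IsBandRepresentation.component_map_sup (hT : IsBandRepresentation B e T) (i : ι)
    (x y : E) : (SX.component i ∘ₗ T).toAddMonoidHom (x ⊔ y) =
      (SX.component i ∘ₗ T).toAddMonoidHom x ⊔ (SX.component i ∘ₗ T).toAddMonoidHom y :=
  (congrArg (SX.component i) (hT.map_sup x y)).trans (SX.component_sup _ _ i)

theorem IsBandRepresentation.injective (hT : IsBandRepresentation B e T)
    (h : IsBandDecomposition B e) : Function.Injective T := by
  rw [injective_iff_map_eq_zero]
  intro x hx
  have hsup : ∀ x y, T.toAddMonoidHom (x ⊔ y) = T.toAddMonoidHom x ⊔ T.toAddMonoidHom y :=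
    hT.map_sup
  refine h.eq_zero_of_abs_inf_unit fun i => ?_
  have he := (h.weakUnit i).nonneg
  have h0 : T (|x| ⊓ e i) = 0 := by
    have h1 := map_inf_of_map_sup hsup |x| (e i)
    rw [map_abs_of_map_sup hsup, show T.toAddMonoidHom x = 0 from hx, abs_zero] at h1
    refine h1.trans (inf_eq_left.2 ?_)
    simpa using monotone_of_map_sup hsup he
  refine (hT.component i).injOn ?_ (zero_mem _) ?_
  · refine (h.band i).solid _ (e i) ?_ (h.weakUnit i).mem
    rw [abs_of_nonneg (le_inf (abs_nonneg x) he), abs_of_nonneg he]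
    exact inf_le_right
  · rw [LinearMap.comp_apply, h0, map_zero, map_zero]

/-- The image of `e i` in the `j`-th component is disjoint from that of `e j`, which is the constant
1, a weak unit of `S(Z j)`. -/
theorem IsBandRepresentation.component_unit_of_ne (hT : IsBandRepresentation B e T)
    (h : IsBandDecomposition B e) {i j : ι} (hij : i ≠ j) : SX.component j (T (e i)) = 0 := by
  have hsup := hT.component_map_sup j
  have hdisj : e i ⊓ e j = 0 := by
    have := h.disjoint i j hij _ (h.weakUnit i).mem _ (h.weakUnit j).mem
    rwa [abs_of_nonneg (h.weakUnit i).nonneg, abs_of_nonneg (h.weakUnit j).nonneg] at this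
  refine SX.eq_zero_of_inf_one ?_ ?_
  · have := monotone_of_map_sup hsup (h.weakUnit i).nonneg
    rwa [map_zero] at this
  · have h1 := map_inf_of_map_sup hsup (e i) (e j)
    rw [hdisj, map_zero] at h1
    rw [← (hT.component j).map_unit]
    exact h1.symm

theorem IsBandRepresentation.component_eq_zero_of_ne (hT : IsBandRepresentation B e T)
    (h : IsBandDecomposition B e) {i j : ι} (hij : i ≠ j) {y : E} (hy : 0 ≤ y) {c : ℝ}
    (hyc : y ≤ c • e i) : SX.component j (T y) = 0 := by
  have hmono := monotone_of_map_sup (hT.component_map_sup j)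
  have h1 := hmono hy
  have h2 := hmono hyc
  rw [map_zero] at h1
  refine le_antisymm (h2.trans_eq ?_) h1
  change SX.component j (T (c • e i)) = 0
  rw [map_smul, map_smul, hT.component_unit_of_ne h hij, smul_zero]

/-- Below every nonzero function supported by an open set there is the image of an element of the
ideal generated by the weak unit. -/
theorem IsWeakUnitRepresentation.exists_le_ofContinuous {X : Type w} [TopologicalSpace X]
    {B : Submodule ℝ E} {e : E} {τ : E →ₗ[ℝ] SX X} (hτ : IsWeakUnitRepresentation B e τ)
    (he : 0 ≤ e) (hsup : ∀ x y, τ (x ⊔ y) = τ x ⊔ τ y) {f : C(X, ℝ)} (hf : ∀ x, 0 ≤ f x) {p : X}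
    (hp : f p = 1) :
    ∃ (y : E) (c : ℝ), 0 ≤ y ∧ y ≤ c • e ∧ τ y ≠ 0 ∧ τ y ≤ SX.ofContinuous f := by
  -- Lowering the approximant by its error `1/4` puts it below `f`; were its positive part zero, `f
  -- ≤ 1/2` would follow, against `f p = 1`.
  obtain ⟨x, ⟨c, hc⟩, hx⟩ := (hτ.closure_eq (SX.ofContinuous f)).1 ⟨f, rfl⟩ (1 / 4) (by norm_num)
  rw [abs_le', neg_sub] at hx
  have hy : τ ((x - (1 / 4 : ℝ) • e) ⊔ 0) =
      (τ x - (1 / 4 : ℝ) • (SX.ofContinuous 1 : SX X)) ⊔ 0 := by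
    rw [hsup, map_sub, map_smul, hτ.map_unit, map_zero]
  refine ⟨(x - (1 / 4 : ℝ) • e) ⊔ 0, c, le_sup_right,
    sup_le ?_ ((abs_nonneg x).trans hc), fun h0 => ?_, ?_⟩
  · refine (sub_le_self x (smul_nonneg (by norm_num) he)).trans ((le_abs_self x).trans hc)
  · rw [hy] at h0
    have h1 : τ x ≤ (1 / 4 : ℝ) • (SX.ofContinuous 1 : SX X) :=
      sub_nonpos.1 (le_sup_left.trans h0.le)
    have h2 : SX.ofContinuous f ≤ SX.ofContinuous ((1 / 2 : ℝ) • 1) := by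
      calc SX.ofContinuous f = (SX.ofContinuous f - τ x) + τ x := (sub_add_cancel _ _).symm
        _ ≤ (1 / 4 : ℝ) • (SX.ofContinuous 1 : SX X) + (1 / 4 : ℝ) • (SX.ofContinuous 1 : SX X) :=
          add_le_add hx.2 h1
        _ = (1 / 2 : ℝ) • (SX.ofContinuous 1 : SX X) := by
          rw [← add_smul]
          norm_num
        _ = _ := rfl
    have h3 := SX.ofContinuous_le_iff.1 h2 p
    rw [hp] at h3
    norm_num at h3
  · rw [hy]
    refine sup_le (sub_le_comm.1 hx.1) ?_
    exact (SX.rep_zero.le_iff (SX.rep_ofContinuous f)).2 (Eventually.of_forall hf)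

theorem IsBandRepresentation.isOrderDense [∀ i, CompactSpace (Z i)] [∀ i, T2Space (Z i)]
    (hT : IsBandRepresentation B e T) (h : IsBandDecomposition B e) :
    IsOrderDense (Set.range T) := by
  intro g hg
  obtain ⟨f, U, hU, hUd, hf, hgf⟩ := g.exists_rep
  have hf0 : ∀ q ∈ U, 0 ≤ f q := fun q hq =>
    le_of_eventually_openDenseFilter hU continuousOn_const hf ((SX.rep_zero.le_iff hgf).1 hg.le) hq
  obtain ⟨⟨i, p⟩, hpU, hp⟩ : ∃ q ∈ U, 0 < f q := by
    by_contra! hle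
    exact hg.not_ge ((hgf.le_iff SX.rep_zero).2 (eventually_openDenseFilter hU hUd hle))
  -- Half the value at the point leaves an open neighbourhood where `f > δ`; `δ` times a bump
  -- supported there is below `f`.
  set δ := f ⟨i, p⟩ / 2 with hδ
  have hδ0 : 0 < δ := half_pos hp
  have hV : IsOpen (Sigma.mk i ⁻¹' (U ∩ f ⁻¹' Set.Ioi δ)) :=
    (hf.isOpen_inter_preimage hU isOpen_Ioi).preimage continuous_sigmaMk
  have hpV : p ∈ Sigma.mk i ⁻¹' (U ∩ f ⁻¹' Set.Ioi δ) := ⟨hpU, half_lt_self hp⟩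
  obtain ⟨k, hk0, hk1, hk01⟩ := exists_continuous_zero_one_of_isClosed hV.isClosed_compl
    (isClosed_singleton (x := p)) (Set.disjoint_singleton_right.2 fun h => h hpV)
  obtain ⟨y, c, hy0, hyc, hyne, hyk⟩ := (hT.component i).exists_le_ofContinuous
    (h.weakUnit i).nonneg (hT.component_map_sup i) (fun x => (hk01 x).1) (hk1 rfl)
  have hsup : ∀ x y, T.toAddMonoidHom (x ⊔ y) = T.toAddMonoidHom x ⊔ T.toAddMonoidHom y :=
    hT.map_sup
  have hδy : 0 ≤ T (δ • y) := by
    have := monotone_of_map_sup hsup (smul_nonneg hδ0.le hy0)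
    rwa [map_zero] at this
  refine ⟨_, ⟨δ • y, rfl⟩, lt_of_le_of_ne hδy fun h0 => hyne ?_, SX.le_iff_component.2 fun j => ?_⟩
  · rw [map_smul, eq_comm, smul_eq_zero_iff_right hδ0.ne'] at h0
    rw [LinearMap.comp_apply, h0, map_zero]
  · rcases eq_or_ne i j with rfl | hij
    · rw [map_smul, map_smul]
      refine (smul_le_smul_of_nonneg_left hyk hδ0.le).trans ?_
      rw [((SX.rep_ofContinuous k).smul δ).le_iff (hgf.component i)]
      refine eventually_openDenseFilter (hU.preimage continuous_sigmaMk)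
        (hUd.preimage isOpenMap_sigmaMk) fun q hq => ?_
      by_cases hqV : q ∈ Sigma.mk i ⁻¹' (U ∩ f ⁻¹' Set.Ioi δ)
      · exact (mul_le_of_le_one_right hδ0.le (hk01 q).2).trans (le_of_lt hqV.2)
      · rw [hk0 hqV, Pi.zero_apply, mul_zero]
        exact hf0 _ hq
    · rw [map_smul, map_smul, hT.component_eq_zero_of_ne h hij hy0 hyc, smul_zero]
      have := SX.le_iff_component.1 hg.le j
      rwa [map_zero] at this

end Properties

theorem theorem3p4 {E : Type u} [Lattice E] [AddCommGroup E] [IsOrderedAddMonoid E]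
    [Module ℝ E] [IsOrderedModule ℝ E] (hE : IsArchimedeanLattice E) :
    -- decompositions exist
    (∃ (ι : Type u) (B : ι → Submodule ℝ E) (e : ι → E), IsBandDecomposition B e) ∧
    -- each decomposition gives a representation
    (∀ (ι : Type v) (B : ι → Submodule ℝ E) (e : ι → E), IsBandDecomposition B e →
      ∃ (Z : ι → Type u) (_ : ∀ i, TopologicalSpace (Z i)) (_ : ∀ i, CompactSpace (Z i))
        (_ : ∀ i, T2Space (Z i)) (T : E →ₗ[ℝ] SX (Σ i, Z i)), IsBandRepresentation B e T) ∧
    -- every such representation has the claimed properties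
    (∀ (ι : Type v) (B : ι → Submodule ℝ E) (e : ι → E), IsBandDecomposition B e →
      ∀ (Z : ι → Type w) [∀ i, TopologicalSpace (Z i)] [∀ i, CompactSpace (Z i)]
        [∀ i, T2Space (Z i)] (T : E →ₗ[ℝ] SX (Σ i, Z i)), IsBandRepresentation B e T →
      Function.Injective T ∧
      (∀ (A : Type w') [Preorder A] [IsDirected A (· ≤ ·)] [Nonempty A] (x : A → E) (a : E),
        OrderConvergesTo x a → OrderConvergesTo (fun i => T (x i)) (T a)) ∧
      (∀ (A : Type w') [Preorder A] [IsDirected A (· ≤ ·)] [Nonempty A] (x : A → E) (a : E),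
        UOConvergesTo x a → UOConvergesTo (fun i => T (x i)) (T a)) ∧
      (∀ (A : Type w') [Preorder A] [IsDirected A (· ≤ ·)] [Nonempty A] (x : A → E) (a : E),
        UOConvergesTo (fun i => T (x i)) (T a) → UOConvergesTo x a) ∧
      IsOrderDense (Set.range T) ∧
      IsRegularIn (Set.range T)) := by
  refine ⟨exists_isBandDecomposition, fun ι B e h => exists_isBandRepresentation hE h, ?_⟩
  intro ι B e h Z _ _ _ T hT
  have hinj : Function.Injective T.toAddMonoidHom := hT.injective h
  have hd : IsOrderDense (Set.range T.toAddMonoidHom) := hT.isOrderDense h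
  have hsup : ∀ x y, T.toAddMonoidHom (x ⊔ y) = T.toAddMonoidHom x ⊔ T.toAddMonoidHom y :=
    hT.map_sup
  refine ⟨hinj, ?_, ?_, ?_, hd, hd.isRegularIn_range⟩
  · intro A _ _ _ x a hx
    exact hx.map_of_isOrderDense hsup hinj hd
  · intro A _ _ _ x a hx
    exact hx.map_of_isOrderDense SX.isArchimedeanLattice hsup hinj hd
  · intro A _ _ _ x a hx
    exact UOConvergesTo.of_map_of_isOrderDense (T := T.toAddMonoidHom) hE hsup hinj hd hx
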